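/- Let $N\ge 0$ and let $\alpha,\beta:[0,1]\to\mathbb R$ be continuously differentiable with $\alpha(0)=\beta(1)=1$, $\alpha(1)=\beta(0)=0$, $\alpha\ge 0$, $\dot\alpha\le 0$, $\beta\ge 0$, $\dot\beta\ge 0$ on $[0,1]$, and $\beta(t)>0$ for $t\in(0,1]$. Let $P_0$ be a Borel probability measure on $\mathbb R^N$ with bounded support (possibly discrete), let $\gamma=\mathcal N(\mathbf 0,\mathbb I_N)$, let $\mathbf x_0\sim P_0$ and $\mathbf z\sim\gamma$ be independent, and put $\mathbf y(t)=\alpha(t)\mathbf x_0+\beta(t)\mathbf z$, with law $P_t$. For $t\in(0,1]$ and $\mathbf y\in\mathbb R^N$ let $P_{t,\mathbf y}$ be the posterior law of $\mathbf x_0$ given $\mathbf y(t)=\mathbf y$, $$P_{t,\mathbf y}(d\mathbf x)=\frac1{Z_t(\mathbf y)}\exp\Big(\frac{\alpha(t)}{\beta(t)^2}\langle \mathbf y,\mathbf x\rangle-\frac{\alpha(t)^2}{2\beta(t)^2}\|\mathbf x\|^2\Big)P_0(d\mathbf x),$$ with $Z_t(\mathbf y)$ the normalizing constant, and define the velocity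 field $$b(\mathbf y,t)=\mathbb E\big[\dot\alpha(t)\mathbf x_0+\dot\beta(t)\mathbf z\,\big|\,\mathbf y(t)=\mathbf y\big]:=\int\Big(\dot\alpha(t)\mathbf x+\dot\beta(t)\frac{\mathbf y-\alpha(t)\mathbf x}{\beta(t)}\Big)P_{t,\mathbf y}(d\mathbf x).$$ Fix $\epsilon\in(0,1)$. Then: (i) for every $t\in[\epsilon,1]$, $b(\cdot,t)$ is continuous and $b(\mathbf y(t),t)=\mathbb E[\dot\alpha(t)\mathbf x_0+\dot\beta(t)\mathbf z\mid\mathbf y(t)]$ almost surely; (ii) the ODE $\frac{d\mathbf Y}{dt}=b(\mathbf Y,t)$, run backward from $t=1$ to $t=\epsilon$, has a unique flow $\mathbf Y_t(\mathbf z)$, $t\in[\epsilon,1]$, with $\mathbf Y_1(\mathbf z)=\mathbf z$ for all $\mathbf z\in\mathbb R^N$; (iii) for every $t\in[\epsilon,1]$ the map $\mathbf Y_t$ is measurable and the pushforward $(\mathbf Y_t)_\#\gamma$ equals the law $P_t$ of $\mathbf y(t)$. -/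

import Mathlib

open MeasureTheory ProbabilityTheory Set

namespace Interpolant

noncomputable section

/-- Admissible coefficients of a one-sided linear interpolant: `α`, `β` are continuously
differentiable on `[0,1]`, `α` decreases from `1` to `0`, `β` increases from `0` to `1`,
and `β` does not vanish at positive times. -/
structure IsSchedule (α β : ℝ → ℝ) : Prop where
  contDiffOn_alpha : ContDiffOn ℝ 1 α (Icc 0 1)
  contDiffOn_beta : ContDiffOn ℝ 1 β (Icc 0 1)
  alpha_zero : α 0 = 1
  alpha_one : α 1 = 0
  beta_zero : β 0 = 0
  beta_one : β 1 = 1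
  alpha_nonneg : ∀ t ∈ Icc (0 : ℝ) 1, 0 ≤ α t
  deriv_alpha_nonpos : ∀ t ∈ Icc (0 : ℝ) 1, derivWithin α (Icc 0 1) t ≤ 0
  beta_nonneg : ∀ t ∈ Icc (0 : ℝ) 1, 0 ≤ β t
  deriv_beta_nonneg : ∀ t ∈ Icc (0 : ℝ) 1, 0 ≤ derivWithin β (Icc 0 1) t
  beta_pos : ∀ t ∈ Ioc (0 : ℝ) 1, 0 < β t

variable {N : ℕ}

/-- The joint law of the independent pair `(x₀, z)` with `x₀ ∼ P₀` and `z ∼ 𝒩(0, I)`. -/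
def jointLaw (P₀ : Measure (EuclideanSpace ℝ (Fin N))) :
    Measure (EuclideanSpace ℝ (Fin N) × EuclideanSpace ℝ (Fin N)) :=
  P₀.prod (stdGaussian (EuclideanSpace ℝ (Fin N)))

/-- The interpolant `y(t) = α(t) x₀ + β(t) z` as a function of the pair `(x₀, z)`. -/
def interp (α β : ℝ → ℝ) (t : ℝ)
    (p : EuclideanSpace ℝ (Fin N) × EuclideanSpace ℝ (Fin N)) : EuclideanSpace ℝ (Fin N) :=
  α t • p.1 + β t • p.2

/-- The time derivative `α'(t) x₀ + β'(t) z` of the interpolant. -/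
def interpDeriv (α β : ℝ → ℝ) (t : ℝ)
    (p : EuclideanSpace ℝ (Fin N) × EuclideanSpace ℝ (Fin N)) : EuclideanSpace ℝ (Fin N) :=
  derivWithin α (Icc 0 1) t • p.1 + derivWithin β (Icc 0 1) t • p.2

/-- The law `P_t` of the interpolant `y(t)`. -/
def interpLaw (P₀ : Measure (EuclideanSpace ℝ (Fin N))) (α β : ℝ → ℝ) (t : ℝ) :
    Measure (EuclideanSpace ℝ (Fin N)) :=
  (jointLaw P₀).map (interp α β t)

/-- The posterior law of `x₀` given `y(t) = y`: the probability measure with density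
proportional to `exp (α/β² ⟨y, x⟩ - α²/(2β²) ‖x‖²)` with respect to `P₀`. -/
def tiltedPosterior (P₀ : Measure (EuclideanSpace ℝ (Fin N))) (α β : ℝ → ℝ) (t : ℝ)
    (y : EuclideanSpace ℝ (Fin N)) : Measure (EuclideanSpace ℝ (Fin N)) :=
  P₀.tilted fun x =>
    α t / β t ^ 2 * inner ℝ y x - α t ^ 2 / (2 * β t ^ 2) * ‖x‖ ^ 2

/-- The velocity field `b(y,t) = 𝔼[α'(t) x₀ + β'(t) z | y(t) = y]`, the expectation being taken
under the posterior law of `x₀`, with `z = (y - α(t) x₀) / β(t)`. -/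
def velocity (P₀ : Measure (EuclideanSpace ℝ (Fin N))) (α β : ℝ → ℝ) (t : ℝ)
    (y : EuclideanSpace ℝ (Fin N)) : EuclideanSpace ℝ (Fin N) :=
  ∫ x, interpDeriv α β t (x, (β t)⁻¹ • (y - α t • x)) ∂(tiltedPosterior P₀ α β t y)

/-- `Y t z` is the flow on `[ε,1]` of the ODE `dY/dt = b(Y,t)` with `Y = z` at time `t = 1`
(one-sided derivatives at the two end points). -/
structure IsBackwardFlow (P₀ : Measure (EuclideanSpace ℝ (Fin N))) (α β : ℝ → ℝ) (ε : ℝ)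
    (Y : ℝ → EuclideanSpace ℝ (Fin N) → EuclideanSpace ℝ (Fin N)) : Prop where
  initial : ∀ z, Y 1 z = z
  hasDerivWithinAt : ∀ z, ∀ t ∈ Icc ε 1,
    HasDerivWithinAt (fun s => Y s z) (velocity P₀ α β t (Y t z)) (Icc ε 1) t

end

end Interpolant

open Interpolant

/-!
For `t > 0` the substitution `w = y / β(t)`, `s = α(t) / β(t)` removes the schedule: the interpolant
becomes `s x₀ + z`, the posterior law of `x₀` becomes `posterior P₀ s w`, with density proportional
to `exp (s ⟪w, x⟫ - s² ‖x‖² / 2)`, and the ODE becomes `dW/ds = m(s, W)` started from the Gaussian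
at `s = 0`, where `m = posteriorMean P₀` (`velocity_eq`, `IsPosteriorFlow.isBackwardFlow`).

Because `P₀` has bounded support, `m` is bounded, Lipschitz in `w`, continuous in `s`, and has
first-order expansions in `w` with uniform quadratic remainder. All of this follows from elementary
estimates for tilted probability measures (`norm_integral_tilted_sub_integral_le` and
`norm_integral_tilted_sub_integral_sub_cov_le`). Global existence of the flow is then
Picard–Lindelöf for a bounded field, and uniqueness is Grönwall's inequality.

The statement about the conditional expectation rests on the Cameron–Martin formula
`map_const_add_stdGaussian`, which shows that the measures `posterior P₀ s w` disintegrate the joint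
law of `x₀` and `s x₀ + z` (`integral_posterior_comp_shear`).

For the transport of the Gaussian (`IsPosteriorFlow.map_stdGaussian`), the differentiability of the
flow in its initial point is avoided by means of the explicit Euler scheme. For a test function `φ`
with a uniform first-order expansion, `𝔼 φ((s + h) x₀ + z)` and the expectation of `φ` after one
Euler step from `s x₀ + z` differ by `O(h²)`: conditionally on `s x₀ + z = v`, the two points are
`v + h x₀` and `v + h 𝔼[x₀ | v]`, so the first-order terms have the same expectation. The class of
test functions is stable under composition with Euler steps (`HasTaylorBound.comp_add_smul`), so the
`O(h²)` errors add up to `O(h)` over the whole interval. Since the scheme converges pointwise to the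
flow, the characteristic functions of the two laws agree.
-/

namespace Interpolant

/-! ### Perturbation of exponentially tilted measures -/

section Tilting

variable {X F : Type*} [MeasurableSpace X] [NormedAddCommGroup F] [NormedSpace ℝ F]
  {μ : Measure X} [IsProbabilityMeasure μ] {h : X → ℝ} {f : X → F} {η C : ℝ}

lemma integrable_exp_of_abs_le (hm : AEMeasurable h μ) (hη : ∀ᵐ x ∂μ, |h x| ≤ η) :
    Integrable (fun x => Real.exp (h x)) μ := by
  refine Integrable.of_bound (Real.measurable_exp.comp_aemeasurable hm).aestronglyMeasurable
    (Real.exp η) ?_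
  filter_upwards [hη] with x hx
  rw [Real.norm_eq_abs, abs_of_pos (Real.exp_pos _)]
  exact Real.exp_le_exp.2 (abs_le.1 hx).2

lemma exp_neg_le_integral_exp (hm : AEMeasurable h μ) (hη : ∀ᵐ x ∂μ, |h x| ≤ η) :
    Real.exp (-η) ≤ ∫ x, Real.exp (h x) ∂μ := by
  have := integral_mono_ae (integrable_const (μ := μ) (Real.exp (-η)))
    (integrable_exp_of_abs_le hm hη)
    (by filter_upwards [hη] with x hx using Real.exp_le_exp.2 (abs_le.1 hx).1)
  simpa using this

lemma integral_exp_le_exp (hm : AEMeasurable h μ) (hη : ∀ᵐ x ∂μ, |h x| ≤ η) :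
    ∫ x, Real.exp (h x) ∂μ ≤ Real.exp η := by
  have := integral_mono_ae (integrable_exp_of_abs_le hm hη)
    (integrable_const (μ := μ) (Real.exp η))
    (by filter_upwards [hη] with x hx using Real.exp_le_exp.2 (abs_le.1 hx).2)
  simpa using this

lemma abs_exp_sub_one_le_mul (k : ℝ) : |Real.exp k - 1| ≤ |k| * (Real.exp k + 1) := by
  have h1 := Real.add_one_le_exp k
  have h2 := Real.add_one_le_exp (-k)
  have h3 : Real.exp k * Real.exp (-k) = 1 := by rw [← Real.exp_add]; simp
  have h4 := Real.exp_pos k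
  rcases le_total 0 k with hk | hk
  · rw [abs_of_nonneg hk, abs_of_nonneg (by linarith)]
    nlinarith
  · rw [abs_of_nonpos hk, abs_of_nonpos (by linarith [Real.exp_le_one_iff.2 hk])]
    nlinarith

/-- The expectation of a bounded function depends Lipschitz-continuously, in the uniform norm, on
the exponent by which a probability measure is tilted. -/
lemma norm_integral_tilted_sub_integral_le (hm : AEMeasurable h μ)
    (hη : ∀ᵐ x ∂μ, |h x| ≤ η) (hf : AEStronglyMeasurable f μ) (hC : ∀ᵐ x ∂μ, ‖f x‖ ≤ C) :
    ‖∫ x, f x ∂(μ.tilted h) - ∫ x, f x ∂μ‖ ≤ 4 * C * η := by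
  have hint := integrable_exp_of_abs_le hm hη
  set Z := ∫ x, Real.exp (h x) ∂μ with hZ
  have hZ1 := exp_neg_le_integral_exp hm hη
  have hZ2 := integral_exp_le_exp hm hη
  have hZpos : 0 < Z := lt_of_lt_of_le (Real.exp_pos _) hZ1
  have hl1 : -η ≤ Real.log Z := by
    rw [Real.le_log_iff_exp_le hZpos]; exact hZ1
  have hl2 : Real.log Z ≤ η := by
    rw [Real.log_le_iff_le_exp hZpos]; exact hZ2
  obtain ⟨x₀, hx₀, hx₀'⟩ := (hη.and hC).exists
  have hη0 : 0 ≤ η := (abs_nonneg _).trans hx₀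
  have hC0 : 0 ≤ C := (norm_nonneg _).trans hx₀'
  have hfi : Integrable f μ := Integrable.of_bound hf C hC
  have hdiv : ∀ x, Real.exp (h x) / Z = Real.exp (h x - Real.log Z) := fun x => by
    rw [Real.exp_sub, Real.exp_log hZpos]
  have hi1 : Integrable (fun x => Real.exp (h x) / Z) μ := hint.div_const _
  have hi2 : Integrable (fun x => (Real.exp (h x) / Z) • f x) μ :=
    hi1.smul_bdd C hf hC
  rw [integral_tilted, ← hZ, ← integral_sub hi2 hfi]
  have hbd : ∀ᵐ x ∂μ, ‖(Real.exp (h x) / Z) • f x - f x‖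
      ≤ (2 * η * C) * (Real.exp (h x) / Z + 1) := by
    filter_upwards [hη, hC] with x hx hxC
    have : (Real.exp (h x) / Z) • f x - f x = (Real.exp (h x) / Z - 1) • f x := by
      rw [sub_smul, one_smul]
    rw [this, norm_smul, Real.norm_eq_abs, hdiv]
    have h1 := abs_exp_sub_one_le_mul (h x - Real.log Z)
    have h2 : |h x - Real.log Z| ≤ 2 * η := by
      rw [abs_le] at hx ⊢
      constructor <;> linarith
    have h3 : 0 < Real.exp (h x - Real.log Z) + 1 := by positivity
    calc _ ≤ (2 * η * (Real.exp (h x - Real.log Z) + 1)) * C :=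
          mul_le_mul (h1.trans (mul_le_mul_of_nonneg_right h2 h3.le)) hxC (norm_nonneg _)
            (by positivity)
      _ = _ := by ring
  refine (norm_integral_le_of_norm_le ((hi1.add (integrable_const 1)).const_mul _) hbd).trans ?_
  have : ∫ x, (2 * η * C) * (Real.exp (h x) / Z + 1) ∂μ = 4 * C * η := by
    rw [integral_const_mul, integral_add hi1 (integrable_const _), integral_div, ← hZ,
      div_self hZpos.ne']
    simp; ring
  exact this.le

/-- Second-order expansion of a tilted expectation: the first-order term is the covariance of the
function with the exponent. -/
lemma norm_integral_tilted_sub_integral_sub_cov_le (hm : AEMeasurable h μ)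
    (hη : ∀ᵐ x ∂μ, |h x| ≤ η) (hf : AEStronglyMeasurable f μ) (hC : ∀ᵐ x ∂μ, ‖f x‖ ≤ C) :
    ‖∫ x, f x ∂(μ.tilted h) - ∫ x, f x ∂μ
      - (∫ x, h x • f x ∂μ - (∫ x, h x ∂μ) • ∫ x, f x ∂μ)‖ ≤ 18 * C * η ^ 2 := by
  have hint := integrable_exp_of_abs_le hm hη
  obtain ⟨x₀, hx₀, hx₀'⟩ := (hη.and hC).exists
  have hη0 : 0 ≤ η := (abs_nonneg _).trans hx₀
  have hC0 : 0 ≤ C := (norm_nonneg _).trans hx₀'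
  have hfi : Integrable f μ := Integrable.of_bound hf C hC
  have hhi : Integrable h μ := Integrable.of_bound hm.aestronglyMeasurable η hη
  have hhf : Integrable (fun x => h x • f x) μ := hhi.smul_bdd C hf hC
  set fb := ∫ x, f x ∂μ with hfb
  set hb := ∫ x, h x ∂μ with hhb
  have hfbC : ‖fb‖ ≤ C := by
    simpa using norm_integral_le_of_norm_le_const hC
  have hhbη : |hb| ≤ η := by
    simpa using norm_integral_le_of_norm_le_const (μ := μ) (f := h) hη
  have hhfC : ‖∫ x, h x • f x ∂μ‖ ≤ η * C := by
    have : ∀ᵐ x ∂μ, ‖h x • f x‖ ≤ η * C := by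
      filter_upwards [hη, hC] with x hx hxC
      rw [norm_smul]
      exact mul_le_mul hx hxC (norm_nonneg _) hη0
    simpa using norm_integral_le_of_norm_le_const this
  have hcov : ‖∫ x, h x • f x ∂μ - hb • fb‖ ≤ 2 * (η * C) := by
    refine (norm_sub_le _ _).trans ?_
    have : ‖hb • fb‖ ≤ η * C := by
      rw [norm_smul]
      exact mul_le_mul hhbη hfbC (norm_nonneg _) hη0
    linarith
  rcases lt_or_ge 1 η with h1 | h1
  · -- for a large exponent the trivial bounds on the three terms suffice
    have h2 := norm_integral_tilted_sub_integral_le hm hη hf hC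
    refine (norm_sub_le _ _).trans ?_
    nlinarith [mul_nonneg hC0 hη0, mul_nonneg (mul_nonneg hC0 hη0) (sub_nonneg.2 h1.le)]
  set Z := ∫ x, Real.exp (h x) ∂μ with hZ
  have hZ1 : Real.exp (-η) ≤ Z := exp_neg_le_integral_exp hm hη
  have hZpos : 0 < Z := lt_of_lt_of_le (Real.exp_pos _) hZ1
  have hZ3 : Z⁻¹ ≤ 3 := by
    rw [inv_le_comm₀ hZpos (by norm_num)]
    refine le_trans ?_ hZ1
    have : Real.exp 1 < 3 := Real.exp_one_lt_three
    calc (3 : ℝ)⁻¹ ≤ (Real.exp 1)⁻¹ := by gcongr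
      _ = Real.exp (-1) := (Real.exp_neg 1).symm
      _ ≤ _ := Real.exp_le_exp.2 (by linarith)
  have hrem : ∀ᵐ x ∂μ, |Real.exp (h x) - 1 - h x| ≤ η ^ 2 := by
    filter_upwards [hη] with x hx
    refine (Real.abs_exp_sub_one_sub_id_le (hx.trans h1)).trans ?_
    rw [← sq_abs]
    gcongr
  have hei : Integrable (fun x => Real.exp (h x) - 1) μ := hint.sub (integrable_const 1)
  have hqi : Integrable (fun x => Real.exp (h x) - 1 - h x) μ := hei.sub hhi
  set q := ∫ x, (Real.exp (h x) - 1 - h x) ∂μ with hq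
  have hqη : |q| ≤ η ^ 2 := by
    simpa using norm_integral_le_of_norm_le_const (μ := μ)
      (f := fun x => Real.exp (h x) - 1 - h x) hrem
  have hri : Integrable (fun x => (Real.exp (h x) - 1 - h x) • f x) μ := hqi.smul_bdd C hf hC
  set r := ∫ x, (Real.exp (h x) - 1 - h x) • f x ∂μ with hr
  have hrη : ‖r‖ ≤ η ^ 2 * C := by
    have : ∀ᵐ x ∂μ, ‖(Real.exp (h x) - 1 - h x) • f x‖ ≤ η ^ 2 * C := by
      filter_upwards [hrem, hC] with x hx hxC
      rw [norm_smul]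
      exact mul_le_mul hx hxC (norm_nonneg _) (by positivity)
    simpa using norm_integral_le_of_norm_le_const this
  have hZq : Z = 1 + hb + q := by
    rw [hq, integral_sub hei hhi, integral_sub hint (integrable_const 1)]
    simp; ring
  have hnum : ∫ x, Real.exp (h x) • f x ∂μ = fb + ∫ x, h x • f x ∂μ + r := by
    have hsi : Integrable (fun x => f x + h x • f x) μ := hfi.add hhf
    rw [hfb, hr, ← integral_add hfi hhf, ← integral_add hsi hri]
    congr 1 with x
    simp only [sub_smul, one_smul]
    abel
  have ht : ∫ x, f x ∂(μ.tilted h) = Z⁻¹ • ∫ x, Real.exp (h x) • f x ∂μ := by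
    rw [integral_tilted, ← integral_smul]
    congr 1 with x
    rw [smul_smul, div_eq_inv_mul]
  set c := ∫ x, h x • f x ∂μ with hc
  -- with `q` and `r` the second-order remainders of `∫ exp h` and `∫ exp h • f`, the error is of
  -- second order: `(hb + q) • (c - hb • fb)` is a product of two first-order terms
  have key : ∫ x, f x ∂(μ.tilted h) - fb - (c - hb • fb)
      = Z⁻¹ • (r - q • fb - (hb + q) • (c - hb • fb)) := by
    rw [ht, hnum, eq_inv_smul_iff₀ hZpos.ne', smul_sub, smul_sub, smul_smul,
      mul_inv_cancel₀ hZpos.ne', one_smul, hZq]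
    module
  rw [key, norm_smul, Real.norm_eq_abs, abs_of_pos (inv_pos.2 hZpos)]
  have b1 : ‖q • fb‖ ≤ η ^ 2 * C := by
    rw [norm_smul]
    exact mul_le_mul hqη hfbC (norm_nonneg _) (by positivity)
  have b2 : ‖(hb + q) • (c - hb • fb)‖ ≤ (2 * η) * (2 * (η * C)) := by
    rw [norm_smul]
    refine mul_le_mul ?_ hcov (norm_nonneg _) (by positivity)
    refine (abs_add_le _ _).trans ?_
    nlinarith
  have b3 : ‖r - q • fb - (hb + q) • (c - hb • fb)‖ ≤ 6 * (C * η ^ 2) := by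
    refine (norm_sub_le _ _).trans ?_
    have := norm_sub_le r (q • fb)
    nlinarith
  calc _ ≤ 3 * (6 * (C * η ^ 2)) := mul_le_mul hZ3 b3 (norm_nonneg _) (by norm_num)
    _ = _ := by ring

end Tilting

/-! ### First-order expansions with uniform quadratic remainder -/

section TaylorBound

variable {E F : Type*} [NormedAddCommGroup E] [NormedSpace ℝ E] [NormedAddCommGroup F]
  [NormedSpace ℝ F]

/-- The function `f` has at every point a linear first-order approximation of norm at most `A`,
with a remainder bounded by `B` times the square of the increment. -/
def HasTaylorBound (f : E → F) (A B : ℝ) : Prop :=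
  ∀ x, ∃ D : E →ₗ[ℝ] F, (∀ u, ‖D u‖ ≤ A * ‖u‖) ∧ ∀ y, ‖f y - f x - D (y - x)‖ ≤ B * ‖y - x‖ ^ 2

/-- Stability of uniform first-order expansions under an explicit Euler step. -/
lemma HasTaylorBound.comp_add_smul {f : E → F} {g : E → E} {A B K L h : ℝ}
    (hf : HasTaylorBound f A B) (hg : HasTaylorBound g K L)
    (hlip : ∀ x y, ‖g y - g x‖ ≤ K * ‖y - x‖) (hA : 0 ≤ A) (hB : 0 ≤ B) (hh : 0 ≤ h) :
    HasTaylorBound (fun x => f (x + h • g x)) (A * (1 + h * K))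
      (B * (1 + h * K) ^ 2 + A * (h * L)) := by
  intro x
  obtain ⟨D, hD, hfD⟩ := hf (x + h • g x)
  obtain ⟨G, hG, hgG⟩ := hg x
  refine ⟨D ∘ₗ (LinearMap.id + h • G), fun u => ?_, fun y => ?_⟩
  · refine (hD _).trans ?_
    rw [mul_assoc]
    refine mul_le_mul_of_nonneg_left ?_ hA
    refine (norm_add_le _ _).trans ?_
    have : ‖(h • G) u‖ ≤ h * (K * ‖u‖) := by
      rw [LinearMap.smul_apply, norm_smul, Real.norm_eq_abs, abs_of_nonneg hh]
      exact mul_le_mul_of_nonneg_left (hG u) hh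
    simp only [LinearMap.id_apply]
    linarith
  · have h1 := hfD (y + h • g y)
    have hinc : ‖y + h • g y - (x + h • g x)‖ ≤ (1 + h * K) * ‖y - x‖ := by
      have : y + h • g y - (x + h • g x) = (y - x) + h • (g y - g x) := by
        rw [smul_sub]; abel
      rw [this]
      refine (norm_add_le _ _).trans ?_
      rw [norm_smul, Real.norm_eq_abs, abs_of_nonneg hh]
      have := mul_le_mul_of_nonneg_left (hlip x y) hh
      linarith
    have h2 : f (y + h • g y) - f (x + h • g x) - (D ∘ₗ (LinearMap.id + h • G)) (y - x)
        = (f (y + h • g y) - f (x + h • g x) - D (y + h • g y - (x + h • g x)))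
          + D (h • (g y - g x - G (y - x))) := by
      have : D (y + h • g y - (x + h • g x))
          = (D ∘ₗ (LinearMap.id + h • G)) (y - x) + D (h • (g y - g x - G (y - x))) := by
        rw [LinearMap.comp_apply, ← map_add]
        congr 1
        simp only [LinearMap.add_apply, LinearMap.id_apply, LinearMap.smul_apply, smul_sub]
        abel
      rw [this]; abel
    rw [h2]
    refine (norm_add_le _ _).trans ?_
    have h3 : ‖D (h • (g y - g x - G (y - x)))‖ ≤ A * (h * (L * ‖y - x‖ ^ 2)) := by
      refine (hD _).trans (mul_le_mul_of_nonneg_left ?_ hA)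
      rw [norm_smul, Real.norm_eq_abs, abs_of_nonneg hh]
      exact mul_le_mul_of_nonneg_left (hgG y) hh
    have h4 : B * ‖y + h • g y - (x + h • g x)‖ ^ 2 ≤ B * ((1 + h * K) * ‖y - x‖) ^ 2 := by
      gcongr
    calc _ ≤ B * ((1 + h * K) * ‖y - x‖) ^ 2 + A * (h * (L * ‖y - x‖ ^ 2)) :=
          add_le_add (h1.trans h4) h3
      _ = _ := by ring

end TaylorBound

/-! ### The posterior mean field -/

section Posterior

variable {E : Type*} [NormedAddCommGroup E] [InnerProductSpace ℝ E] [FiniteDimensional ℝ E]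
  [MeasurableSpace E] [BorelSpace E]

/-- The logarithm of the likelihood ratio, at the observation `v`, between `s x + z` and `z`, where
`z` is a standard Gaussian vector. -/
noncomputable def logWeight (s : ℝ) (v x : E) : ℝ := s * inner ℝ v x - s ^ 2 / 2 * ‖x‖ ^ 2

/-- The posterior law of `x₀ ∼ P` given `s x₀ + z = v`, where `z` is a standard Gaussian vector
independent of `x₀`. -/
noncomputable def posterior (P : Measure E) (s : ℝ) (v : E) : Measure E :=
  P.tilted (logWeight s v)

/-- The expectation of `x₀ ∼ P` given `s x₀ + z = v`, where `z` is a standard Gaussian vector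
independent of `x₀`. -/
noncomputable def posteriorMean (P : Measure E) (s : ℝ) (v : E) : E :=
  ∫ x, x ∂(posterior P s v)

omit [FiniteDimensional ℝ E] in
@[fun_prop]
lemma measurable_logWeight (s : ℝ) (v : E) : Measurable (logWeight s v) := by
  unfold logWeight
  have : Continuous fun x : E => s * inner ℝ v x - s ^ 2 / 2 * ‖x‖ ^ 2 := by fun_prop
  exact this.measurable

omit [FiniteDimensional ℝ E] [MeasurableSpace E] [BorelSpace E] in
lemma abs_logWeight_sub_le {R : ℝ} {x : E} (hx : ‖x‖ ≤ R) (s s' : ℝ) (v v' : E) :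
    |logWeight s' v' x - logWeight s v x|
      ≤ ‖s' • v' - s • v‖ * R + |s' ^ 2 - s ^ 2| / 2 * R ^ 2 := by
  have h : logWeight s' v' x - logWeight s v x
      = inner ℝ (s' • v' - s • v) x - (s' ^ 2 - s ^ 2) / 2 * ‖x‖ ^ 2 := by
    simp only [logWeight, inner_sub_left, real_inner_smul_left]
    ring
  rw [h]
  refine (abs_sub _ _).trans (add_le_add ?_ ?_)
  · exact (abs_real_inner_le_norm _ _).trans (by gcongr)
  · rw [abs_mul, abs_div, abs_of_pos (two_pos : (0 : ℝ) < 2), abs_of_nonneg (sq_nonneg ‖x‖)]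
    gcongr

omit [FiniteDimensional ℝ E] [MeasurableSpace E] [BorelSpace E] in
lemma abs_logWeight_le {R : ℝ} {x : E} (hx : ‖x‖ ≤ R) (s : ℝ) (v : E) :
    |logWeight s v x| ≤ ‖s • v‖ * R + s ^ 2 / 2 * R ^ 2 := by
  have := abs_logWeight_sub_le hx 0 s 0 v
  simpa [logWeight, abs_of_nonneg (sq_nonneg s)] using this

variable {P : Measure E} [IsProbabilityMeasure P] {R : ℝ}

omit [FiniteDimensional ℝ E] in
lemma integrable_exp_logWeight (hR : ∀ᵐ x ∂P, ‖x‖ ≤ R) (s : ℝ) (v : E) :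
    Integrable (fun x => Real.exp (logWeight s v x)) P :=
  integrable_exp_of_abs_le (measurable_logWeight s v).aemeasurable
    (by filter_upwards [hR] with x hx using abs_logWeight_le hx s v)

omit [FiniteDimensional ℝ E] in
lemma isProbabilityMeasure_posterior (hR : ∀ᵐ x ∂P, ‖x‖ ≤ R) (s : ℝ) (v : E) :
    IsProbabilityMeasure (posterior P s v) :=
  isProbabilityMeasure_tilted (integrable_exp_logWeight hR s v)

omit [FiniteDimensional ℝ E] [BorelSpace E] [IsProbabilityMeasure P] in
lemma ae_posterior_norm_le (hR : ∀ᵐ x ∂P, ‖x‖ ≤ R) (s : ℝ) (v : E) :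
    ∀ᵐ x ∂(posterior P s v), ‖x‖ ≤ R :=
  (tilted_absolutelyContinuous P (logWeight s v)).ae_le hR

omit [FiniteDimensional ℝ E] in
lemma posterior_eq_tilted_posterior (hR : ∀ᵐ x ∂P, ‖x‖ ≤ R) (s s' : ℝ) (v v' : E) :
    posterior P s' v' = (posterior P s v).tilted (logWeight s' v' - logWeight s v) := by
  rw [posterior, posterior, tilted_tilted (integrable_exp_logWeight hR s v)]
  congr 1
  abel

omit [IsProbabilityMeasure P] in
lemma integrable_posterior_id (hR : ∀ᵐ x ∂P, ‖x‖ ≤ R) (s : ℝ) (v : E)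
    [IsProbabilityMeasure (posterior P s v)] : Integrable (fun x : E => x) (posterior P s v) :=
  Integrable.of_bound aestronglyMeasurable_id R (ae_posterior_norm_le hR s v)

omit [FiniteDimensional ℝ E] in
lemma norm_posteriorMean_le (hR : ∀ᵐ x ∂P, ‖x‖ ≤ R) (s : ℝ) (v : E) :
    ‖posteriorMean P s v‖ ≤ R := by
  have := isProbabilityMeasure_posterior hR s v
  simpa [posteriorMean] using norm_integral_le_of_norm_le_const (ae_posterior_norm_le hR s v)

/-- Joint Lipschitz estimate for the posterior mean in the two parameters `s • v` and `s ^ 2` of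
the tilting exponent. -/
lemma norm_posteriorMean_sub_le (hR : ∀ᵐ x ∂P, ‖x‖ ≤ R) (s s' : ℝ) (v v' : E) :
    ‖posteriorMean P s' v' - posteriorMean P s v‖
      ≤ 4 * R * (‖s' • v' - s • v‖ * R + |s' ^ 2 - s ^ 2| / 2 * R ^ 2) := by
  have := isProbabilityMeasure_posterior hR s v
  rw [posteriorMean, posteriorMean, posterior_eq_tilted_posterior hR s s' v v']
  refine norm_integral_tilted_sub_integral_le
    ((measurable_logWeight s' v').sub (measurable_logWeight s v)).aemeasurable ?_
    aestronglyMeasurable_id (ae_posterior_norm_le hR s v)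
  filter_upwards [ae_posterior_norm_le hR s v] with x hx using abs_logWeight_sub_le hx s s' v v'

lemma norm_posteriorMean_sub_le_mul (hR : ∀ᵐ x ∂P, ‖x‖ ≤ R) (s : ℝ) (v v' : E) :
    ‖posteriorMean P s v' - posteriorMean P s v‖ ≤ 4 * R ^ 2 * |s| * ‖v' - v‖ := by
  refine (norm_posteriorMean_sub_le hR s s v v').trans (le_of_eq ?_)
  rw [← smul_sub, norm_smul, Real.norm_eq_abs]
  simp
  ring

/-- The posterior mean admits uniform first-order expansions in the observation; the linear part
is `s` times the posterior covariance. -/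
lemma hasTaylorBound_posteriorMean (hR : ∀ᵐ x ∂P, ‖x‖ ≤ R) {s S : ℝ} (hs : s ∈ Icc 0 S) :
    HasTaylorBound (posteriorMean P s) (4 * R ^ 2 * S) (18 * R ^ 3 * S ^ 2) := by
  intro v
  have := isProbabilityMeasure_posterior hR s v
  have hR' := ae_posterior_norm_le hR s v
  have hR0 : 0 ≤ R := (norm_nonneg _).trans (norm_posteriorMean_le hR s v)
  set μ := posterior P s v with hμ
  have hid : Integrable (fun x : E => x) μ := integrable_posterior_id hR s v
  have hin : ∀ u : E, ∀ᵐ x ∂μ, |(inner ℝ u x : ℝ)| ≤ ‖u‖ * R := fun u => by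
    filter_upwards [hR'] with x hx
    exact (abs_real_inner_le_norm _ _).trans (by gcongr)
  have hinm : ∀ u : E, AEStronglyMeasurable (fun x : E => (inner ℝ u x : ℝ)) μ := fun u => by
    have : Continuous fun x : E => (inner ℝ u x : ℝ) := by fun_prop
    exact this.aestronglyMeasurable
  have hini : ∀ u : E, Integrable (fun x : E => (inner ℝ u x : ℝ)) μ := fun u =>
    Integrable.of_bound (hinm u) _ (hin u)
  have hins : ∀ u : E, Integrable (fun x : E => (inner ℝ u x : ℝ) • x) μ := fun u =>
    (hini u).smul_bdd R aestronglyMeasurable_id hR'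
  let D : E →ₗ[ℝ] E :=
    { toFun := fun u =>
        s • (∫ x, (inner ℝ u x : ℝ) • x ∂μ - (∫ x, (inner ℝ u x : ℝ) ∂μ) • ∫ x, x ∂μ)
      map_add' := fun u w => by
        simp only [inner_add_left, add_smul]
        rw [integral_add (hins u) (hins w), integral_add (hini u) (hini w)]
        module
      map_smul' := fun c u => by
        simp only [real_inner_smul_left, mul_smul, RingHom.id_apply]
        rw [integral_smul, integral_const_mul]
        module }
  have hDapp : ∀ u, D u = s • (∫ x, (inner ℝ u x : ℝ) • x ∂μ
      - (∫ x, (inner ℝ u x : ℝ) ∂μ) • ∫ x, x ∂μ) := fun u => rfl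
  refine ⟨D, fun u => ?_, fun y => ?_⟩
  · rw [hDapp, norm_smul, Real.norm_eq_abs, abs_of_nonneg hs.1]
    have h1 : ‖∫ x, (inner ℝ u x : ℝ) • x ∂μ‖ ≤ ‖u‖ * R * R := by
      have : ∀ᵐ x ∂μ, ‖(inner ℝ u x : ℝ) • x‖ ≤ ‖u‖ * R * R := by
        filter_upwards [hin u, hR'] with x hx hx'
        rw [norm_smul]
        exact mul_le_mul hx hx' (norm_nonneg _) (by positivity)
      simpa using norm_integral_le_of_norm_le_const this
    have h2 : ‖(∫ x, (inner ℝ u x : ℝ) ∂μ) • ∫ x, x ∂μ‖ ≤ ‖u‖ * R * R := by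
      rw [norm_smul]
      refine mul_le_mul ?_ ?_ (norm_nonneg _) (by positivity)
      · simpa using norm_integral_le_of_norm_le_const (μ := μ)
          (f := fun x => (inner ℝ u x : ℝ)) (hin u)
      · simpa using norm_integral_le_of_norm_le_const hR'
    have h3 := (norm_sub_le _ _).trans (add_le_add h1 h2)
    calc _ ≤ S * (‖u‖ * R * R + ‖u‖ * R * R) :=
          mul_le_mul hs.2 h3 (norm_nonneg _) (hs.1.trans hs.2)
      _ ≤ _ := by
        nlinarith [mul_nonneg (mul_nonneg (sq_nonneg R) (hs.1.trans hs.2)) (norm_nonneg u)]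
  · have hdiff : ∀ x, logWeight s y x - logWeight s v x = s * inner ℝ (y - v) x := fun x => by
      simp only [logWeight, inner_sub_left]; ring
    have hfun : logWeight s y - logWeight s v = fun x => s * inner ℝ (y - v) x :=
      funext hdiff
    have hmeas : AEMeasurable (fun x => s * (inner ℝ (y - v) x : ℝ)) μ :=
      ((hinm (y - v)).const_mul s).aemeasurable
    have hbd : ∀ᵐ x ∂μ, |s * (inner ℝ (y - v) x : ℝ)| ≤ S * (‖y - v‖ * R) := by
      filter_upwards [hin (y - v)] with x hx
      rw [abs_mul, abs_of_nonneg hs.1]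
      exact mul_le_mul hs.2 hx (abs_nonneg _) (hs.1.trans hs.2)
    have key := norm_integral_tilted_sub_integral_sub_cov_le hmeas hbd
      (aestronglyMeasurable_id : AEStronglyMeasurable (fun x : E => x) μ) hR'
    have hD : D (y - v) = ∫ x, (s * (inner ℝ (y - v) x : ℝ)) • x ∂μ
        - (∫ x, s * (inner ℝ (y - v) x : ℝ) ∂μ) • ∫ x, x ∂μ := by
      rw [hDapp, integral_const_mul]
      simp only [mul_smul]
      rw [integral_smul, smul_sub]
    rw [hD, posteriorMean, posteriorMean, posterior_eq_tilted_posterior hR s s v y, hfun]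
    refine key.trans (le_of_eq ?_)
    ring

end Posterior

/-! ### The Gaussian shift and the disintegration of the joint law -/

section Shift

variable {E F : Type*} [NormedAddCommGroup E] [InnerProductSpace ℝ E] [FiniteDimensional ℝ E]
  [MeasurableSpace E] [BorelSpace E] [NormedAddCommGroup F] [NormedSpace ℝ F]

/-- The Laplace–Fourier transform of the standard Gaussian. -/
lemma integral_cexp_inner_stdGaussian (a t : E) :
    ∫ v, Complex.exp ((inner ℝ v a : ℝ) + (inner ℝ v t : ℝ) * Complex.I) ∂(stdGaussian E)
      = Complex.exp (((‖a‖ ^ 2 - ‖t‖ ^ 2 : ℝ) : ℂ) / 2 + (inner ℝ a t : ℝ) * Complex.I) := by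
  rw [stdGaussian, integral_map (Measurable.aemeasurable (by fun_prop))
    (Measurable.aestronglyMeasurable (by fun_prop))]
  set b := stdOrthonormalBasis ℝ E with hb
  have h1D : ∀ c : ℂ, ∫ x : ℝ, Complex.exp (c * x) ∂(gaussianReal 0 1)
      = Complex.exp (c ^ 2 / 2) := fun c => by
    have := complexMGF_gaussianReal (p := gaussianReal 0 1) (X := id) (μ := 0) (v := 1)
      (by simp) c
    simpa [complexMGF] using this
  have hexp : ∀ x : Fin (Module.finrank ℝ E) → ℝ,
      Complex.exp ((inner ℝ (∑ i, x i • b i) a : ℝ) + (inner ℝ (∑ i, x i • b i) t : ℝ) * Complex.I)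
        = ∏ i, Complex.exp (((inner ℝ (b i) a : ℝ) + (inner ℝ (b i) t : ℝ) * Complex.I) * x i) := by
    intro x
    rw [← Complex.exp_sum]
    congr 1
    simp only [sum_inner, real_inner_smul_left, Complex.ofReal_sum, Complex.ofReal_mul,
      Finset.sum_mul, ← Finset.sum_add_distrib]
    exact Finset.sum_congr rfl fun i _ => by ring
  simp_rw [hexp]
  rw [integral_fintype_prod_eq_prod (fun i (x : ℝ) =>
    Complex.exp (((inner ℝ (b i) a : ℝ) + (inner ℝ (b i) t : ℝ) * Complex.I) * x))]
  simp_rw [h1D]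
  rw [← Complex.exp_sum]
  congr 1
  have hna : ‖a‖ ^ 2 = ∑ i, inner ℝ (b i) a ^ 2 := (b.sum_sq_inner_right a).symm
  have hnt : ‖t‖ ^ 2 = ∑ i, inner ℝ (b i) t ^ 2 := (b.sum_sq_inner_right t).symm
  have hat : (inner ℝ a t : ℝ) = ∑ i, inner ℝ (b i) a * inner ℝ (b i) t := by
    rw [← b.sum_inner_mul_inner a t]
    exact Finset.sum_congr rfl fun i _ => by rw [real_inner_comm]
  rw [hna, hnt, hat, ← Finset.sum_sub_distrib]
  push_cast
  rw [Finset.sum_div, Finset.sum_mul, ← Finset.sum_add_distrib]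
  refine Finset.sum_congr rfl fun i _ => ?_
  have := Complex.I_sq
  linear_combination (((inner ℝ (b i) t : ℝ) : ℂ) ^ 2 / 2) * this

/-- The Cameron–Martin formula: translating the standard Gaussian by `a` multiplies it by the
density `exp (⟪v, a⟫ - ‖a‖ ^ 2 / 2)`. -/
lemma map_const_add_stdGaussian (a : E) :
    (stdGaussian E).map (a + ·) = (stdGaussian E).withDensity
      (fun v => ENNReal.ofReal (Real.exp (inner ℝ v a - ‖a‖ ^ 2 / 2))) := by
  have hmeas : Measurable fun v : E => Real.exp (inner ℝ v a - ‖a‖ ^ 2 / 2) := by fun_prop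
  have hcexp : ∀ v : E, ((Real.exp (inner ℝ v a - ‖a‖ ^ 2 / 2) : ℝ) : ℂ)
      = Complex.exp (-(‖a‖ ^ 2 / 2 : ℝ))
        * Complex.exp ((inner ℝ v a : ℝ) + (inner ℝ v 0 : ℝ) * Complex.I) := by
    intro v
    rw [← Complex.exp_add, Complex.ofReal_exp]
    congr 1
    simp
    ring
  -- a function whose integral does not vanish is integrable
  have hint : Integrable (fun v : E => Real.exp (inner ℝ v a - ‖a‖ ^ 2 / 2)) (stdGaussian E) := by
    have h : Integrable (fun v : E => ((Real.exp (inner ℝ v a - ‖a‖ ^ 2 / 2) : ℝ) : ℂ))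
        (stdGaussian E) := by
      simp_rw [hcexp]
      refine Integrable.const_mul ?_ _
      by_contra hcon
      have h0 := integral_undef hcon
      rw [integral_cexp_inner_stdGaussian] at h0
      exact Complex.exp_ne_zero _ h0
    exact h.re
  have : IsFiniteMeasure ((stdGaussian E).withDensity
      (fun v => ENNReal.ofReal (Real.exp (inner ℝ v a - ‖a‖ ^ 2 / 2)))) :=
    isFiniteMeasure_withDensity_ofReal hint.2
  refine Measure.ext_of_charFun ?_
  ext t
  rw [charFun_map_const_add, charFun_stdGaussian, charFun_apply,
    integral_withDensity_eq_integral_toReal_smul (by fun_prop) (by simp)]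
  have hpt : ∀ v : E, (ENNReal.ofReal (Real.exp (inner ℝ v a - ‖a‖ ^ 2 / 2))).toReal •
      Complex.exp ((inner ℝ v t : ℝ) * Complex.I) = Complex.exp (-(‖a‖ ^ 2 / 2 : ℝ)) *
        Complex.exp ((inner ℝ v a : ℝ) + (inner ℝ v t : ℝ) * Complex.I) := by
    intro v
    rw [ENNReal.toReal_ofReal (Real.exp_pos _).le, Complex.real_smul, Complex.ofReal_exp,
      ← Complex.exp_add, ← Complex.exp_add]
    congr 1
    push_cast
    ring
  simp_rw [hpt]
  rw [integral_const_mul, integral_cexp_inner_stdGaussian, ← Complex.exp_add, ← Complex.exp_add]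
  congr 1
  push_cast
  ring

variable {P : Measure E} [IsProbabilityMeasure P] {R s : ℝ} {G : E × E → F}

@[fun_prop]
lemma measurable_logWeight_uncurry (s : ℝ) :
    Measurable fun p : E × E => logWeight s p.2 p.1 := by
  unfold logWeight
  fun_prop

/-- The joint law of `(x₀, s x₀ + z)` has density `exp (logWeight s v x)` with respect to the law of
`(x₀, z)`. -/
lemma map_shear_eq_withDensity (P : Measure E) [IsProbabilityMeasure P] (s : ℝ) :
    (P.prod (stdGaussian E)).map (fun p => (p.1, s • p.1 + p.2))
      = (P.prod (stdGaussian E)).withDensity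
        (fun p => ENNReal.ofReal (Real.exp (logWeight s p.2 p.1))) := by
  have hm : Measurable fun p : E × E => (p.1, s • p.1 + p.2) := by fun_prop
  have hd : Measurable fun p : E × E => ENNReal.ofReal (Real.exp (logWeight s p.2 p.1)) := by
    fun_prop
  refine Measure.ext_of_lintegral _ fun f hf => ?_
  rw [lintegral_map hf hm, lintegral_withDensity_eq_lintegral_mul _ hd hf,
    lintegral_prod _ (by fun_prop), lintegral_prod _ (hd.mul hf).aemeasurable]
  refine lintegral_congr fun x => ?_
  have h1 : ∫⁻ z, f (x, s • x + z) ∂(stdGaussian E)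
      = ∫⁻ v, f (x, v) ∂((stdGaussian E).map (s • x + ·)) :=
    (lintegral_map (f := fun v => f (x, v)) (by fun_prop) (by fun_prop)).symm
  simp only
  rw [h1, map_const_add_stdGaussian,
    lintegral_withDensity_eq_lintegral_mul _ (by fun_prop) (by fun_prop)]
  refine lintegral_congr fun v => ?_
  have : (inner ℝ v (s • x) : ℝ) - ‖s • x‖ ^ 2 / 2 = logWeight s v x := by
    rw [logWeight, real_inner_smul_right, norm_smul, Real.norm_eq_abs, mul_pow, sq_abs]
    ring
  simp only [Pi.mul_apply, this]

lemma integral_comp_shear (hG : StronglyMeasurable G) :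
    ∫ p, G (p.1, s • p.1 + p.2) ∂(P.prod (stdGaussian E))
      = ∫ p, Real.exp (logWeight s p.2 p.1) • G p ∂(P.prod (stdGaussian E)) := by
  have h : ∫ p, G (p.1, s • p.1 + p.2) ∂(P.prod (stdGaussian E))
      = ∫ p, G p ∂((P.prod (stdGaussian E)).map (fun p => (p.1, s • p.1 + p.2))) :=
    (integral_map (Measurable.aemeasurable (by fun_prop)) hG.aestronglyMeasurable).symm
  rw [h, map_shear_eq_withDensity,
    integral_withDensity_eq_integral_toReal_smul (by fun_prop) (by simp)]
  simp only [ENNReal.toReal_ofReal (Real.exp_pos _).le]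

lemma integrable_comp_shear_iff (hG : StronglyMeasurable G) :
    Integrable (fun p => G (p.1, s • p.1 + p.2)) (P.prod (stdGaussian E))
      ↔ Integrable (fun p => Real.exp (logWeight s p.2 p.1) • G p)
        (P.prod (stdGaussian E)) := by
  have h := integrable_map_measure (μ := P.prod (stdGaussian E)) (g := G)
    (f := fun p => (p.1, s • p.1 + p.2)) hG.aestronglyMeasurable
    (Measurable.aemeasurable (by fun_prop))
  rw [map_shear_eq_withDensity,
    integrable_withDensity_iff_integrable_smul' (by fun_prop) (by simp)] at h
  simp only [ENNReal.toReal_ofReal (Real.exp_pos _).le] at h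
  exact h.symm

omit [FiniteDimensional ℝ E] [BorelSpace E] in
lemma integral_posterior (P : Measure E) (s : ℝ) (v : E) (f : E → F) :
    ∫ x, f x ∂(posterior P s v)
      = (∫ x, Real.exp (logWeight s v x) ∂P)⁻¹ • ∫ x, Real.exp (logWeight s v x) • f x ∂P := by
  rw [posterior, integral_tilted, ← integral_smul]
  congr 1 with x
  rw [smul_smul, div_eq_inv_mul]

lemma stronglyMeasurable_integral_posterior (hG : StronglyMeasurable G) :
    StronglyMeasurable fun v => ∫ x, G (x, v) ∂(posterior P s v) := by
  simp_rw [integral_posterior]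
  refine StronglyMeasurable.smul ?_ ?_
  · have h : StronglyMeasurable fun p : E × E => Real.exp (logWeight s p.2 p.1) :=
      Measurable.stronglyMeasurable (by fun_prop)
    exact (h.integral_prod_left (μ := P)).measurable.inv.stronglyMeasurable
  · have h : StronglyMeasurable fun p : E × E => Real.exp (logWeight s p.2 p.1) • G p :=
      (Measurable.stronglyMeasurable (by fun_prop)).smul hG
    exact h.integral_prod_left (μ := P)

/-- The measures `posterior P s v` disintegrate the joint law of `x₀` and `s x₀ + z`: replacing
`x₀` by an independent sample of its posterior law does not change expectations. -/
lemma integral_posterior_comp_shear [CompleteSpace F] (hR : ∀ᵐ x ∂P, ‖x‖ ≤ R)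
    (hG : StronglyMeasurable G)
    (hint : Integrable (fun p => G (p.1, s • p.1 + p.2)) (P.prod (stdGaussian E)))
    (hint' : Integrable (fun p : E × E => ∫ x, G (x, s • p.1 + p.2)
      ∂(posterior P s (s • p.1 + p.2))) (P.prod (stdGaussian E))) :
    ∫ p : E × E, ∫ x, G (x, s • p.1 + p.2) ∂(posterior P s (s • p.1 + p.2))
        ∂(P.prod (stdGaussian E))
      = ∫ p, G (p.1, s • p.1 + p.2) ∂(P.prod (stdGaussian E)) := by
  have hH : StronglyMeasurable fun p : E × E => ∫ x, G (x, p.2) ∂(posterior P s p.2) :=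
    (stronglyMeasurable_integral_posterior hG).comp_measurable measurable_snd
  have e1 := integral_comp_shear (P := P) (s := s) hG
  have e2 := integral_comp_shear (P := P) (s := s) hH
  rw [integral_prod_symm _ ((integrable_comp_shear_iff hG).1 hint)] at e1
  rw [integral_prod_symm _ ((integrable_comp_shear_iff hH).1 hint')] at e2
  rw [e1]
  refine e2.trans (integral_congr_ae (Filter.Eventually.of_forall fun v => ?_))
  have hZ : 0 < ∫ x, Real.exp (logWeight s v x) ∂P :=
    integral_exp_pos (integrable_exp_logWeight hR s v)
  simp only
  rw [integral_smul_const, integral_posterior, smul_inv_smul₀ hZ.ne']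

end Shift

/-! ### Solutions of the ODE and the Euler scheme -/

section Euler

variable {E : Type*} [NormedAddCommGroup E] [NormedSpace ℝ E]

/-- A bounded time-dependent vector field, Lipschitz in space and continuous in time, has integral
curves on the whole time interval. -/
lemma exists_hasDerivWithinAt_of_bounded [CompleteSpace E] {g : ℝ → E → E} {S : ℝ} (hS : 0 ≤ S)
    {K R : NNReal} (hlip : ∀ s ∈ Icc 0 S, LipschitzWith K (g s))
    (hcont : ∀ x, ContinuousOn (fun s => g s x) (Icc 0 S))
    (hbdd : ∀ s x, ‖g s x‖ ≤ R) (z : E) :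
    ∃ f : ℝ → E, f 0 = z ∧ ∀ s ∈ Icc 0 S, HasDerivWithinAt f (g s (f s)) (Icc 0 S) s := by
  have hp : IsPicardLindelof g (⟨0, left_mem_Icc.2 hS⟩ : Icc (0 : ℝ) S) z
      (R * Real.toNNReal S) 0 R K :=
    { lipschitzOnWith := fun s hs => (hlip s hs).lipschitzOnWith
      continuousOn := fun x _ => hcont x
      norm_le := fun s _ x _ => hbdd s x
      mul_max_le := by simp [hS] }
  exact hp.exists_eq_forall_mem_Icc_hasDerivWithinAt₀

/-- The explicit Euler scheme with step `h` for the vector field `g`, started at time `0`. -/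
def euler (g : ℝ → E → E) (h : ℝ) : ℕ → E → E
  | 0 => fun z => z
  | k + 1 => fun z => euler g h k z + h • g (k * h) (euler g h k z)

/-- Global error of the Euler scheme, obtained by summing the consistency errors `L h²` of the
single steps, each amplified by at most `1 + h K` in every later step. -/
lemma norm_euler_sub_le {g : ℝ → E → E} {f : ℝ → E} {K L S h : ℝ} (hK : 0 ≤ K) (hL : 0 ≤ L)
    (hh : 0 ≤ h) (hf : ∀ s ∈ Icc 0 S, HasDerivWithinAt f (g s (f s)) (Icc 0 S) s)
    (hlip : ∀ s ∈ Icc 0 S, ∀ x y, ‖g s y - g s x‖ ≤ K * ‖y - x‖)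
    (htime : ∀ s ∈ Icc 0 S, ∀ t ∈ Icc 0 S, ‖g t (f t) - g s (f s)‖ ≤ L * |t - s|) (k : ℕ)
    (hk : k * h ≤ S) :
    ‖euler g h k (f 0) - f (k * h)‖ ≤ k * (L * h ^ 2) * (1 + h * K) ^ k := by
  induction k with
  | zero => simp [euler]
  | succ k ih =>
    have hkS : k * h ≤ S := by push_cast at hk; nlinarith
    have ih := ih hkS
    set s := (k : ℝ) * h with hs
    have hs1 : ((k + 1 : ℕ) : ℝ) * h = s + h := by push_cast; ring
    have hs0 : 0 ≤ s := by positivity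
    rw [hs1] at hk ⊢
    have hsub : Icc s (s + h) ⊆ Icc 0 S := Icc_subset_Icc hs0 hk
    have hsI : s ∈ Icc 0 S := ⟨hs0, hkS⟩
    -- consistency error of one step
    have hloc : ‖f (s + h) - f s - h • g s (f s)‖ ≤ L * h ^ 2 := by
      have hd : ∀ t ∈ Icc s (s + h), HasDerivWithinAt (fun t => f t - (t - s) • g s (f s))
          (g t (f t) - g s (f s)) (Icc s (s + h)) t := fun t ht => by
        have h1 := (hf t (hsub ht)).mono hsub
        have h2 : HasDerivWithinAt (fun t : ℝ => (t - s) • g s (f s)) ((1 : ℝ) • g s (f s))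
            (Icc s (s + h)) t := ((hasDerivWithinAt_id t _).sub_const s).smul_const _
        rw [one_smul] at h2
        exact h1.sub h2
      have hb : ∀ t ∈ Icc s (s + h), ‖g t (f t) - g s (f s)‖ ≤ L * h := fun t ht => by
        refine (htime s hsI t (hsub ht)).trans (mul_le_mul_of_nonneg_left ?_ hL)
        rw [abs_of_nonneg (by linarith [ht.1])]
        linarith [ht.2]
      have := (convex_Icc s (s + h)).norm_image_sub_le_of_norm_hasDerivWithin_le hd hb
        (left_mem_Icc.2 (by linarith)) (right_mem_Icc.2 (by linarith))
      simp only [add_sub_cancel_left, sub_self, zero_smul, sub_zero, Real.norm_eq_abs,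
        abs_of_nonneg hh] at this
      have e : f (s + h) - f s - h • g s (f s) = f (s + h) - h • g s (f s) - f s := by abel
      rw [e]
      linarith
    set x := euler g h k (f 0) with hx
    have hstep : euler g h (k + 1) (f 0) - f (s + h)
        = (x - f s) + h • (g s x - g s (f s)) - (f (s + h) - f s - h • g s (f s)) := by
      simp only [euler, ← hx, ← hs, smul_sub]
      abel
    have h1 : ‖h • (g s x - g s (f s))‖ ≤ h * (K * ‖x - f s‖) := by
      rw [norm_smul, Real.norm_eq_abs, abs_of_nonneg hh]
      exact mul_le_mul_of_nonneg_left (hlip s hsI _ _) hh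
    have h2 := (norm_sub_le ((x - f s) + h • (g s x - g s (f s)))
      (f (s + h) - f s - h • g s (f s))).trans
        (add_le_add ((norm_add_le _ _).trans (add_le_add le_rfl h1)) hloc)
    rw [hstep]
    have hq : 1 ≤ (1 + h * K) ^ (k + 1) := one_le_pow₀ (by nlinarith [mul_nonneg hh hK])
    have hLh : 0 ≤ L * h ^ 2 := by positivity
    calc _ ≤ (1 + h * K) * ‖x - f s‖ + L * h ^ 2 := by linarith
      _ ≤ (1 + h * K) * (k * (L * h ^ 2) * (1 + h * K) ^ k)
          + L * h ^ 2 * (1 + h * K) ^ (k + 1) := by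
        refine add_le_add (mul_le_mul_of_nonneg_left ih (by positivity)) ?_
        exact le_mul_of_one_le_right hLh hq
      _ = _ := by push_cast; ring

lemma one_add_mul_pow_le_exp {h K : ℝ} (hh : 0 ≤ h * K) (k : ℕ) :
    (1 + h * K) ^ k ≤ Real.exp (k * h * K) := by
  calc (1 + h * K) ^ k ≤ Real.exp (h * K) ^ k := by
        gcongr
        linarith [Real.add_one_le_exp (h * K)]
    _ = _ := by rw [← Real.exp_nat_mul]; ring_nf

/-- The explicit Euler scheme converges to the integral curve. -/
lemma tendsto_euler {g : ℝ → E → E} {f : ℝ → E} {K L S s : ℝ} (hK : 0 ≤ K) (hL : 0 ≤ L)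
    (hf : ∀ s ∈ Icc 0 S, HasDerivWithinAt f (g s (f s)) (Icc 0 S) s)
    (hlip : ∀ s ∈ Icc 0 S, ∀ x y, ‖g s y - g s x‖ ≤ K * ‖y - x‖)
    (htime : ∀ s ∈ Icc 0 S, ∀ t ∈ Icc 0 S, ‖g t (f t) - g s (f s)‖ ≤ L * |t - s|)
    (hs : s ∈ Icc 0 S) :
    Filter.Tendsto (fun n : ℕ => euler g (s / (n + 1 : ℕ)) (n + 1) (f 0)) Filter.atTop
      (nhds (f s)) := by
  rw [tendsto_iff_norm_sub_tendsto_zero]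
  have hlim : Filter.Tendsto (fun n : ℕ => L * s ^ 2 * Real.exp (s * K) * (1 / ((n : ℝ) + 1)))
      Filter.atTop (nhds 0) := by
    simpa using tendsto_one_div_add_atTop_nhds_zero_nat.const_mul (L * s ^ 2 * Real.exp (s * K))
  refine squeeze_zero (fun _ => norm_nonneg _) (fun n => ?_) hlim
  have hn : ((n + 1 : ℕ) : ℝ) ≠ 0 := by positivity
  have hh : 0 ≤ s / ((n + 1 : ℕ) : ℝ) := div_nonneg hs.1 (by positivity)
  have hns : ((n + 1 : ℕ) : ℝ) * (s / ((n + 1 : ℕ) : ℝ)) = s := mul_div_cancel₀ s hn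
  have key := norm_euler_sub_le hK hL hh hf hlip htime (n + 1) (hns.le.trans hs.2)
  have hexp := one_add_mul_pow_le_exp (mul_nonneg hh hK) (n + 1)
  rw [hns] at key hexp
  refine key.trans ((mul_le_mul_of_nonneg_left hexp (by positivity)).trans (le_of_eq ?_))
  push_cast
  field_simp

end Euler

section PosteriorFlow

variable {E : Type*} [NormedAddCommGroup E] [InnerProductSpace ℝ E] [FiniteDimensional ℝ E]
  [MeasurableSpace E] [BorelSpace E] {P : Measure E} [IsProbabilityMeasure P] {R S : ℝ}

/-- A family of curves `s ↦ W s z` on `[0, S]`, issued from `z`, that follow the posterior mean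
field. -/
structure IsPosteriorFlow (P : Measure E) (S : ℝ) (W : ℝ → E → E) : Prop where
  initial : ∀ z, W 0 z = z
  hasDerivWithinAt : ∀ z, ∀ s ∈ Icc 0 S,
    HasDerivWithinAt (fun s => W s z) (posteriorMean P s (W s z)) (Icc 0 S) s

lemma norm_posteriorMean_sub_le_of_mem (hR : ∀ᵐ x ∂P, ‖x‖ ≤ R) {s : ℝ} (hs : s ∈ Icc 0 S)
    (v v' : E) :
    ‖posteriorMean P s v' - posteriorMean P s v‖ ≤ 4 * R ^ 2 * S * ‖v' - v‖ := by
  refine (norm_posteriorMean_sub_le_mul hR s v v').trans ?_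
  rw [abs_of_nonneg hs.1]
  gcongr
  exact hs.2

lemma continuous_posteriorMean_time (hR : ∀ᵐ x ∂P, ‖x‖ ≤ R) (v : E) :
    Continuous fun s => posteriorMean P s v := by
  rw [continuous_iff_continuousAt]
  intro s
  rw [ContinuousAt, tendsto_iff_norm_sub_tendsto_zero]
  refine squeeze_zero (fun _ => norm_nonneg _)
    (fun s' => norm_posteriorMean_sub_le hR s s' v v) ?_
  have : Continuous fun s' : ℝ =>
      4 * R * (‖s' • v - s • v‖ * R + |s' ^ 2 - s ^ 2| / 2 * R ^ 2) := by fun_prop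
  simpa using this.tendsto s

lemma continuous_posteriorMean (hR : ∀ᵐ x ∂P, ‖x‖ ≤ R) (s : ℝ) :
    Continuous (posteriorMean P s) :=
  (LipschitzWith.of_dist_le_mul (K := Real.toNNReal (4 * R ^ 2 * |s|)) fun v' v => by
    rw [dist_eq_norm, dist_eq_norm, Real.coe_toNNReal _ (by positivity)]
    exact norm_posteriorMean_sub_le_mul hR s v v').continuous

lemma exists_isPosteriorFlow (hR : ∀ᵐ x ∂P, ‖x‖ ≤ R) (hS : 0 ≤ S) :
    ∃ W, IsPosteriorFlow P S W := by
  have hR0 : 0 ≤ R := (norm_nonneg _).trans (norm_posteriorMean_le hR 0 0)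
  have h := fun z => exists_hasDerivWithinAt_of_bounded (g := posteriorMean P) hS
    (K := ⟨4 * R ^ 2 * S, by positivity⟩) (R := ⟨R, hR0⟩)
    (fun s hs => LipschitzWith.of_dist_le_mul fun v' v => by
      rw [dist_eq_norm, dist_eq_norm]
      exact norm_posteriorMean_sub_le_of_mem hR hs v v')
    (fun x => (continuous_posteriorMean_time hR x).continuousOn)
    (fun s x => norm_posteriorMean_le hR s x) z
  choose W h0 hW using h
  exact ⟨fun s z => W z s, h0, hW⟩

/-- Along a curve of the flow the velocity is Lipschitz in time. -/
lemma IsPosteriorFlow.norm_posteriorMean_sub_le {W : ℝ → E → E} (hW : IsPosteriorFlow P S W)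
    (hR : ∀ᵐ x ∂P, ‖x‖ ≤ R) (z : E) {s t : ℝ} (hs : s ∈ Icc 0 S) (ht : t ∈ Icc 0 S) :
    ‖posteriorMean P t (W t z) - posteriorMean P s (W s z)‖
      ≤ (4 * R * ((‖z‖ + 2 * S * R) * R + S * R ^ 2)) * |t - s| := by
  have hR0 : 0 ≤ R := (norm_nonneg _).trans (norm_posteriorMean_le hR 0 0)
  have hS : 0 ≤ S := hs.1.trans hs.2
  have hlipW : ∀ s ∈ Icc 0 S, ∀ t ∈ Icc 0 S, ‖W t z - W s z‖ ≤ R * |t - s| := fun s hs t ht =>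
    (convex_Icc 0 S).norm_image_sub_le_of_norm_hasDerivWithin_le (hW.hasDerivWithinAt z)
      (fun s _ => norm_posteriorMean_le hR s _) hs ht
  have hWt : ‖W t z‖ ≤ ‖z‖ + S * R := by
    have h1 := hlipW 0 (left_mem_Icc.2 hS) t ht
    rw [hW.initial, sub_zero, abs_of_nonneg ht.1] at h1
    have h2 := norm_le_norm_add_norm_sub z (W t z)
    have h3 := mul_le_mul_of_nonneg_left ht.2 hR0
    rw [norm_sub_rev] at h2
    linarith
  have h1 : ‖t • W t z - s • W s z‖ ≤ (‖z‖ + 2 * S * R) * |t - s| := by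
    have e : t • W t z - s • W s z = (t - s) • W t z + s • (W t z - W s z) := by module
    rw [e]
    refine (norm_add_le _ _).trans ?_
    rw [norm_smul, norm_smul, Real.norm_eq_abs, Real.norm_eq_abs, abs_of_nonneg hs.1]
    have a1 := mul_le_mul_of_nonneg_left hWt (abs_nonneg (t - s))
    have a2 := mul_le_mul hs.2 (hlipW s hs t ht) (norm_nonneg _) hS
    linarith
  have h2 : |t ^ 2 - s ^ 2| ≤ 2 * S * |t - s| := by
    have e : t ^ 2 - s ^ 2 = (t + s) * (t - s) := by ring
    rw [e, abs_mul, abs_of_nonneg (add_nonneg ht.1 hs.1)]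
    exact mul_le_mul_of_nonneg_right (by linarith [hs.2, ht.2]) (abs_nonneg _)
  refine (Interpolant.norm_posteriorMean_sub_le hR s t (W s z) (W t z)).trans ?_
  calc _ ≤ 4 * R * (((‖z‖ + 2 * S * R) * |t - s|) * R + (2 * S * |t - s|) / 2 * R ^ 2) := by
        gcongr
    _ = _ := by ring

lemma IsPosteriorFlow.tendsto_euler {W : ℝ → E → E} (hW : IsPosteriorFlow P S W)
    (hR : ∀ᵐ x ∂P, ‖x‖ ≤ R) (z : E) {s : ℝ} (hs : s ∈ Icc 0 S) :
    Filter.Tendsto (fun n : ℕ => euler (posteriorMean P) (s / (n + 1 : ℕ)) (n + 1) z)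
      Filter.atTop (nhds (W s z)) := by
  have hR0 : 0 ≤ R := (norm_nonneg _).trans (norm_posteriorMean_le hR 0 0)
  have hS : 0 ≤ S := hs.1.trans hs.2
  have := Interpolant.tendsto_euler (g := posteriorMean P) (f := fun s => W s z)
    (K := 4 * R ^ 2 * S) (L := 4 * R * ((‖z‖ + 2 * S * R) * R + S * R ^ 2)) (by positivity)
    (by positivity) (hW.hasDerivWithinAt z)
    (fun s hs x y => norm_posteriorMean_sub_le_of_mem hR hs x y)
    (fun s hs t ht => hW.norm_posteriorMean_sub_le hR z hs ht) hs
  simpa only [hW.initial] using this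

lemma continuous_euler_posteriorMean (hR : ∀ᵐ x ∂P, ‖x‖ ≤ R) (h : ℝ) (k : ℕ) :
    Continuous (euler (posteriorMean P) h k) := by
  induction k with
  | zero => exact continuous_id
  | succ k ih => exact ih.add (((continuous_posteriorMean hR _).comp ih).const_smul h)

lemma IsPosteriorFlow.measurable {W : ℝ → E → E} (hW : IsPosteriorFlow P S W)
    (hR : ∀ᵐ x ∂P, ‖x‖ ≤ R) {s : ℝ} (hs : s ∈ Icc 0 S) : Measurable (W s) :=
  measurable_of_tendsto_metrizable
    (fun n : ℕ => (continuous_euler_posteriorMean hR (s / (n + 1 : ℕ)) (n + 1)).measurable)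
    (tendsto_pi_nhds.2 fun z => hW.tendsto_euler hR z hs)

end PosteriorFlow

/-! ### Transport of the Gaussian by the posterior mean flow -/

section Transport

variable {E F : Type*} [NormedAddCommGroup E] [InnerProductSpace ℝ E] [FiniteDimensional ℝ E]
  [MeasurableSpace E] [BorelSpace E] [NormedAddCommGroup F] [NormedSpace ℝ F] [CompleteSpace F]
  {P : Measure E} [IsProbabilityMeasure P] {R S : ℝ}

/-- Under the posterior law, moving by `h x` or by `h` times the posterior mean changes the
expectation of a smooth function by a quantity of second order in `h` only: the first-order term is
linear in `x`. -/
lemma norm_integral_posterior_sub_le {φ : E → F} {A B : ℝ} (hφ : HasTaylorBound φ A B)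
    (hcont : Continuous φ) (hB : 0 ≤ B) {C : ℝ} (hC : ∀ x, ‖φ x‖ ≤ C)
    (hR : ∀ᵐ x ∂P, ‖x‖ ≤ R) (s h : ℝ) (v : E) :
    ‖∫ x, φ (v + h • x) ∂(posterior P s v) - φ (v + h • posteriorMean P s v)‖
      ≤ 4 * R ^ 2 * h ^ 2 * B := by
  have := isProbabilityMeasure_posterior hR s v
  have hR' := ae_posterior_norm_le hR s v
  have hmR := norm_posteriorMean_le hR s v
  set m := posteriorMean P s v with hm
  obtain ⟨D, -, hD⟩ := hφ (v + h • m)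
  let D' : E →L[ℝ] F := LinearMap.toContinuousLinearMap D
  have hid : Integrable (fun x : E => x) (posterior P s v) := integrable_posterior_id hR s v
  have hi : Integrable (fun x : E => h • (x - m)) (posterior P s v) :=
    (hid.sub (integrable_const m)).smul h
  have hzero : ∫ x, D (h • (x - m)) ∂(posterior P s v) = 0 := by
    have h1 : ∫ x, D' (h • (x - m)) ∂(posterior P s v)
        = D' (∫ x, h • (x - m) ∂(posterior P s v)) := D'.integral_comp_comm hi
    have h2 : ∫ x, h • (x - m) ∂(posterior P s v) = 0 := by
      rw [integral_smul, integral_sub hid (integrable_const m)]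
      simp [hm, posteriorMean]
    rw [h2, map_zero] at h1
    exact h1
  have hDi : Integrable (fun x => D (h • (x - m))) (posterior P s v) := D'.integrable_comp hi
  have hφi : Integrable (fun x => φ (v + h • x)) (posterior P s v) :=
    Integrable.of_bound (hcont.comp (by fun_prop)).aestronglyMeasurable C
      (Filter.Eventually.of_forall fun x => hC _)
  have hci : Integrable (fun _ : E => φ (v + h • m)) (posterior P s v) := integrable_const _
  have hsub : Integrable (fun x => φ (v + h • x) - φ (v + h • m)) (posterior P s v) :=
    hφi.sub hci
  have key : ∫ x, φ (v + h • x) ∂(posterior P s v) - φ (v + h • m)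
      = ∫ x, (φ (v + h • x) - φ (v + h • m) - D (h • (x - m))) ∂(posterior P s v) := by
    rw [integral_sub hsub hDi, hzero, sub_zero, integral_sub hφi hci]
    simp
  rw [key]
  have hbd : ∀ᵐ x ∂(posterior P s v),
      ‖φ (v + h • x) - φ (v + h • m) - D (h • (x - m))‖ ≤ 4 * R ^ 2 * h ^ 2 * B := by
    filter_upwards [hR'] with x hx
    have e : v + h • x - (v + h • m) = h • (x - m) := by module
    have h1 := hD (v + h • x)
    rw [e] at h1
    refine h1.trans ?_
    rw [norm_smul, mul_pow, Real.norm_eq_abs, sq_abs]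
    have h2 : ‖x - m‖ ≤ 2 * R := (norm_sub_le _ _).trans (by linarith)
    calc B * (h ^ 2 * ‖x - m‖ ^ 2) ≤ B * (h ^ 2 * (2 * R) ^ 2) := by gcongr
      _ = _ := by ring
  simpa using norm_integral_le_of_norm_le_const hbd

/-- Weak consistency: for the law of `s x₀ + z`, advancing the parameter by `h` and performing one
Euler step along the posterior mean agree up to second order in `h`. -/
lemma norm_integral_add_sub_integral_step_le {φ : E → F} {A B : ℝ} (hφ : HasTaylorBound φ A B)
    (hcont : Continuous φ) (hB : 0 ≤ B) {C : ℝ} (hC : ∀ x, ‖φ x‖ ≤ C)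
    (hR : ∀ᵐ x ∂P, ‖x‖ ≤ R) (s h : ℝ) :
    ‖∫ p : E × E, φ ((s + h) • p.1 + p.2) ∂(P.prod (stdGaussian E))
      - ∫ p : E × E, φ (s • p.1 + p.2 + h • posteriorMean P s (s • p.1 + p.2))
        ∂(P.prod (stdGaussian E))‖ ≤ 4 * R ^ 2 * h ^ 2 * B := by
  have hG : StronglyMeasurable fun q : E × E => φ (q.2 + h • q.1) :=
    (hcont.comp (by fun_prop)).stronglyMeasurable
  have hint : Integrable (fun p : E × E => φ (s • p.1 + p.2 + h • p.1))
      (P.prod (stdGaussian E)) :=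
    Integrable.of_bound (hcont.comp (by fun_prop)).aestronglyMeasurable C
      (Filter.Eventually.of_forall fun x => hC _)
  have hint' : Integrable (fun p : E × E => ∫ x, φ (s • p.1 + p.2 + h • x)
      ∂(posterior P s (s • p.1 + p.2))) (P.prod (stdGaussian E)) := by
    refine Integrable.of_bound (((stronglyMeasurable_integral_posterior (P := P) (s := s)
      hG).comp_measurable (g := fun p : E × E => s • p.1 + p.2)
        (by fun_prop)).aestronglyMeasurable) C (Filter.Eventually.of_forall fun p => ?_)
    have := isProbabilityMeasure_posterior hR s (s • p.1 + p.2)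
    simpa using norm_integral_le_of_norm_le_const (μ := posterior P s (s • p.1 + p.2))
      (f := fun x => φ (s • p.1 + p.2 + h • x)) (Filter.Eventually.of_forall fun x => hC _)
  have hstep : Integrable (fun p : E × E =>
      φ (s • p.1 + p.2 + h • posteriorMean P s (s • p.1 + p.2))) (P.prod (stdGaussian E)) := by
    have hc := continuous_posteriorMean hR s
    exact Integrable.of_bound (hcont.comp (by fun_prop)).aestronglyMeasurable C
      (Filter.Eventually.of_forall fun x => hC _)
  have e1 : ∫ p : E × E, φ ((s + h) • p.1 + p.2) ∂(P.prod (stdGaussian E))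
      = ∫ p : E × E, ∫ x, φ (s • p.1 + p.2 + h • x) ∂(posterior P s (s • p.1 + p.2))
        ∂(P.prod (stdGaussian E)) := by
    rw [integral_posterior_comp_shear hR hG hint hint']
    congr 1 with p
    congr 1
    module
  rw [e1, ← integral_sub hint' hstep]
  simpa using norm_integral_le_of_norm_le_const (μ := P.prod (stdGaussian E))
    (Filter.Eventually.of_forall fun p : E × E =>
      norm_integral_posterior_sub_le hφ hcont hB hC hR s h (s • p.1 + p.2))

/-- Weak error of the Euler scheme: the law of the scheme after `k` steps of length `h`, started
from the Gaussian, is compared with the law of `k h x₀ + z`. The errors of the successive steps are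
propagated by composing the test function with the later Euler maps. -/
lemma norm_integral_sub_integral_euler_le (hR : ∀ᵐ x ∂P, ‖x‖ ≤ R) {h : ℝ} (hh : 0 ≤ h) {C : ℝ}
    (k : ℕ) (hk : k * h ≤ S) (φ : E → F) (A B : ℝ) (hA : 0 ≤ A) (hB : 0 ≤ B)
    (hφ : HasTaylorBound φ A B) (hcont : Continuous φ) (hC : ∀ x, ‖φ x‖ ≤ C) :
    ‖∫ p : E × E, φ ((k * h) • p.1 + p.2) ∂(P.prod (stdGaussian E))
      - ∫ z, φ (euler (posteriorMean P) h k z) ∂(stdGaussian E)‖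
      ≤ k * (4 * R ^ 2 * h ^ 2) * (B + k * (A * (h * (18 * R ^ 3 * S ^ 2))))
        * ((1 + h * (4 * R ^ 2 * S)) ^ 2) ^ k := by
  have hR0 : 0 ≤ R := (norm_nonneg _).trans (norm_posteriorMean_le hR 0 0)
  induction k generalizing φ A B with
  | zero =>
    have : ∫ p : E × E, φ p.2 ∂(P.prod (stdGaussian E)) = ∫ z, φ z ∂(stdGaussian E) := by
      rw [integral_fun_snd]
      simp
    simp [euler, this]
  | succ k ih =>
    have hkS : k * h ≤ S := by push_cast at hk; nlinarith
    have hkh : 0 ≤ k * h := by positivity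
    have hS : 0 ≤ S := hkh.trans hkS
    set K := 4 * R ^ 2 * S with hK
    set L := 18 * R ^ 3 * S ^ 2 with hL
    have hK0 : 0 ≤ K := by positivity
    have hL0 : 0 ≤ L := by positivity
    have hmem : (k : ℝ) * h ∈ Icc 0 S := ⟨hkh, hkS⟩
    have hc := continuous_posteriorMean hR (k * h)
    have hφ' := hφ.comp_add_smul (hasTaylorBound_posteriorMean hR hmem)
      (fun x y => norm_posteriorMean_sub_le_of_mem hR hmem x y) hA hB hh
    rw [← hK, ← hL] at hφ'
    have h1 := ih hkS _ _ _ (by positivity) (by positivity) hφ' (hcont.comp (by fun_prop))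
      (fun x => hC _)
    have h2 := norm_integral_add_sub_integral_step_le hφ hcont hB hC hR (k * h) h
    have e : ((k + 1 : ℕ) : ℝ) * h = k * h + h := by push_cast; ring
    rw [e]
    simp only [euler]
    refine (norm_sub_le_norm_sub_add_norm_sub _ _ _).trans ((add_le_add h2 h1).trans ?_)
    -- `q` dominates the growth under one Euler step of both constants of the test function
    set q := (1 + h * K) ^ 2 with hq
    have hq1 : 1 ≤ q := one_le_pow₀ (by nlinarith [mul_nonneg hh hK0])
    have hq2 : 1 + h * K ≤ q := by nlinarith [mul_nonneg hh hK0]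
    have hc0 : 0 ≤ 4 * R ^ 2 * h ^ 2 := by positivity
    set c := 4 * R ^ 2 * h ^ 2 with hcdef
    set d := h * L with hd
    have hd0 : 0 ≤ d := by positivity
    have hsum : B * q + A * d + k * (A * (1 + h * K) * d) ≤ (B + (k + 1) * (A * d)) * q := by
      have t1 : A * d ≤ A * d * q := le_mul_of_one_le_right (by positivity) hq1
      have t2 : A * d * (1 + h * K) ≤ A * d * q := mul_le_mul_of_nonneg_left hq2 (by positivity)
      have t3 := mul_le_mul_of_nonneg_left t2 (Nat.cast_nonneg (α := ℝ) k)
      nlinarith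
    have hBle : c * B ≤ c * (B + (k + 1) * (A * d)) * q ^ (k + 1) := by
      have t1 : B ≤ B + (k + 1) * (A * d) := by
        have : 0 ≤ ((k : ℝ) + 1) * (A * d) := by positivity
        linarith
      have t2 : 0 ≤ c * (B + (k + 1) * (A * d)) := by positivity
      calc c * B ≤ c * (B + (k + 1) * (A * d)) := mul_le_mul_of_nonneg_left t1 hc0
        _ ≤ _ := le_mul_of_one_le_right t2 (one_le_pow₀ hq1)
    have hrec : k * c * (B * q + A * d + k * (A * (1 + h * K) * d)) * q ^ k
        ≤ k * c * ((B + (k + 1) * (A * d)) * q) * q ^ k := by gcongr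
    calc c * B + k * c * (B * q + A * d + k * (A * (1 + h * K) * d)) * q ^ k
        ≤ c * (B + (k + 1) * (A * d)) * q ^ (k + 1)
          + k * c * ((B + (k + 1) * (A * d)) * q) * q ^ k := add_le_add hBle hrec
      _ = _ := by push_cast; ring

omit [FiniteDimensional ℝ E] [MeasurableSpace E] [BorelSpace E] in
/-- The characters, which determine a finite measure, are admissible test functions. -/
lemma hasTaylorBound_cexp_inner (t : E) :
    HasTaylorBound (fun x : E => Complex.exp ((inner ℝ x t : ℝ) * Complex.I)) ‖t‖
      (3 * ‖t‖ ^ 2) := by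
  have hrem : ∀ u : ℝ, ‖Complex.exp (u * Complex.I) - 1 - u * Complex.I‖ ≤ 3 * u ^ 2 := by
    intro u
    have hn : ‖(u : ℂ) * Complex.I‖ = |u| := by simp
    rcases le_or_gt |u| 1 with hu | hu
    · refine (Complex.norm_exp_sub_one_sub_id_le (hn.trans_le hu)).trans ?_
      rw [hn, sq_abs]
      nlinarith [sq_nonneg u]
    · have h1 : ‖Complex.exp (u * Complex.I)‖ = 1 := Complex.norm_exp_ofReal_mul_I u
      have h2 := norm_sub_le (Complex.exp (u * Complex.I) - 1) (u * Complex.I)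
      have h3 := norm_sub_le (Complex.exp (u * Complex.I)) 1
      rw [norm_one] at h3
      rw [hn] at h2
      rw [← sq_abs]
      nlinarith
  intro x
  refine ⟨{ toFun := fun u => Complex.exp ((inner ℝ x t : ℝ) * Complex.I)
              * ((inner ℝ u t : ℝ) * Complex.I)
            map_add' := fun u w => by
              rw [inner_add_left]; push_cast; ring
            map_smul' := fun c u => by
              rw [real_inner_smul_left, Complex.real_smul, RingHom.id_apply]
              push_cast
              ring }, fun u => ?_, fun y => ?_⟩
  · simp only [LinearMap.coe_mk, AddHom.coe_mk]
    rw [norm_mul, Complex.norm_exp_ofReal_mul_I, one_mul, norm_mul, Complex.norm_I, mul_one,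
      Complex.norm_real, mul_comm]
    exact abs_real_inner_le_norm u t
  · simp only [LinearMap.coe_mk, AddHom.coe_mk]
    have e : Complex.exp ((inner ℝ y t : ℝ) * Complex.I)
        = Complex.exp ((inner ℝ x t : ℝ) * Complex.I)
        * Complex.exp ((inner ℝ (y - x) t : ℝ) * Complex.I) := by
      rw [← Complex.exp_add, inner_sub_left]
      congr 1
      push_cast
      ring
    have e2 : Complex.exp ((inner ℝ y t : ℝ) * Complex.I)
        - Complex.exp ((inner ℝ x t : ℝ) * Complex.I)
        - Complex.exp ((inner ℝ x t : ℝ) * Complex.I) * ((inner ℝ (y - x) t : ℝ) * Complex.I)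
        = Complex.exp ((inner ℝ x t : ℝ) * Complex.I)
          * (Complex.exp ((inner ℝ (y - x) t : ℝ) * Complex.I) - 1
            - (inner ℝ (y - x) t : ℝ) * Complex.I) := by
      rw [e]; ring
    rw [e2, norm_mul, Complex.norm_exp_ofReal_mul_I, one_mul]
    refine (hrem _).trans ?_
    have h1 : (inner ℝ (y - x) t : ℝ) ^ 2 ≤ (‖y - x‖ * ‖t‖) ^ 2 := by
      rw [← sq_abs]
      gcongr
      exact abs_real_inner_le_norm _ _
    nlinarith

/-- The flow of the posterior mean field transports the standard Gaussian to the law of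
`s x₀ + z`. -/
theorem IsPosteriorFlow.map_stdGaussian {W : ℝ → E → E} (hW : IsPosteriorFlow P S W)
    (hR : ∀ᵐ x ∂P, ‖x‖ ≤ R) {s : ℝ} (hs : s ∈ Icc 0 S) :
    (stdGaussian E).map (W s)
      = (P.prod (stdGaussian E)).map (fun p : E × E => s • p.1 + p.2) := by
  have hR0 : 0 ≤ R := (norm_nonneg _).trans (norm_posteriorMean_le hR 0 0)
  have hS : 0 ≤ S := hs.1.trans hs.2
  have hWm := hW.measurable hR hs
  have : IsProbabilityMeasure ((stdGaussian E).map (W s)) :=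
    Measure.isProbabilityMeasure_map hWm.aemeasurable
  have hVm : Measurable fun p : E × E => s • p.1 + p.2 := by fun_prop
  have : IsProbabilityMeasure
      ((P.prod (stdGaussian E)).map (fun p : E × E => s • p.1 + p.2)) :=
    Measure.isProbabilityMeasure_map hVm.aemeasurable
  refine Measure.ext_of_charFun ?_
  ext t
  set φ : E → ℂ := fun x => Complex.exp ((inner ℝ x t : ℝ) * Complex.I) with hφ
  have hcont : Continuous φ := by fun_prop
  have hC : ∀ x, ‖φ x‖ ≤ 1 := fun x => (Complex.norm_exp_ofReal_mul_I _).le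
  rw [charFun_apply, charFun_apply, integral_map hWm.aemeasurable hcont.aestronglyMeasurable,
    integral_map hVm.aemeasurable hcont.aestronglyMeasurable]
  have hlim1 : Filter.Tendsto (fun n : ℕ =>
      ∫ z, φ (euler (posteriorMean P) (s / (n + 1 : ℕ)) (n + 1) z) ∂(stdGaussian E))
      Filter.atTop (nhds (∫ z, φ (W s z) ∂(stdGaussian E))) := by
    refine tendsto_integral_of_dominated_convergence (fun _ => 1) (fun n => ?_)
      (integrable_const _) (fun n => Filter.Eventually.of_forall fun z => hC _)
      (Filter.Eventually.of_forall fun z =>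
        (hcont.tendsto _).comp (hW.tendsto_euler hR z hs))
    exact (hcont.comp (continuous_euler_posteriorMean hR _ _)).aestronglyMeasurable
  have hlim2 : Filter.Tendsto (fun n : ℕ =>
      ∫ z, φ (euler (posteriorMean P) (s / (n + 1 : ℕ)) (n + 1) z) ∂(stdGaussian E))
      Filter.atTop (nhds (∫ p : E × E, φ (s • p.1 + p.2) ∂(P.prod (stdGaussian E)))) := by
    rw [tendsto_iff_norm_sub_tendsto_zero]
    set c := 4 * R ^ 2 * s ^ 2 * (3 * ‖t‖ ^ 2 + s * (‖t‖ * (18 * R ^ 3 * S ^ 2)))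
      * Real.exp (2 * (s * (4 * R ^ 2 * S))) with hc
    have hlim : Filter.Tendsto (fun n : ℕ => c * (1 / ((n : ℝ) + 1))) Filter.atTop (nhds 0) := by
      simpa using tendsto_one_div_add_atTop_nhds_zero_nat.const_mul c
    refine squeeze_zero (fun _ => norm_nonneg _) (fun n => ?_) hlim
    have hn : ((n + 1 : ℕ) : ℝ) ≠ 0 := by positivity
    have hh : 0 ≤ s / ((n + 1 : ℕ) : ℝ) := div_nonneg hs.1 (by positivity)
    have hns : ((n + 1 : ℕ) : ℝ) * (s / ((n + 1 : ℕ) : ℝ)) = s := mul_div_cancel₀ s hn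
    have key := norm_integral_sub_integral_euler_le hR hh (n + 1) (hns.le.trans hs.2) φ ‖t‖
      (3 * ‖t‖ ^ 2) (norm_nonneg _) (by positivity) (hasTaylorBound_cexp_inner t) hcont hC
    have hexp := one_add_mul_pow_le_exp (K := 4 * R ^ 2 * S)
      (mul_nonneg hh (by positivity)) (n + 1)
    rw [hns] at key hexp
    rw [norm_sub_rev]
    refine key.trans ?_
    have hpow : ((1 + s / ((n + 1 : ℕ) : ℝ) * (4 * R ^ 2 * S)) ^ 2) ^ (n + 1)
        ≤ Real.exp (2 * (s * (4 * R ^ 2 * S))) := by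
      rw [← pow_mul, mul_comm 2 (n + 1), pow_mul, two_mul, Real.exp_add, ← sq]
      gcongr
    have hs0 := hs.1
    refine (mul_le_mul_of_nonneg_left hpow (by positivity)).trans (le_of_eq ?_)
    rw [hc]
    push_cast
    field_simp
  exact tendsto_nhds_unique hlim1 hlim2

end Transport

/-! ### The velocity field of the interpolant -/

section Velocity

variable {N : ℕ} {P₀ : Measure (EuclideanSpace ℝ (Fin N))} {α β : ℝ → ℝ} {t R : ℝ}

lemma tiltedPosterior_eq_posterior (hβ : β t ≠ 0) (y : EuclideanSpace ℝ (Fin N)) :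
    tiltedPosterior P₀ α β t y = posterior P₀ (α t / β t) ((β t)⁻¹ • y) := by
  rw [tiltedPosterior, posterior]
  congr 1 with x
  rw [logWeight, real_inner_smul_left]
  field_simp

variable [IsProbabilityMeasure P₀]

/-- In the rescaled variable `(β t)⁻¹ • y` the velocity is a linear term plus a multiple of the
posterior mean at the parameter `α t / β t`. -/
lemma velocity_eq (hR : ∀ᵐ x ∂P₀, ‖x‖ ≤ R) (hβ : β t ≠ 0) (y : EuclideanSpace ℝ (Fin N)) :
    velocity P₀ α β t y = derivWithin β (Icc 0 1) t • (β t)⁻¹ • y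
      + (derivWithin α (Icc 0 1) t - derivWithin β (Icc 0 1) t * (α t / β t)) •
        posteriorMean P₀ (α t / β t) ((β t)⁻¹ • y) := by
  have := isProbabilityMeasure_posterior hR (α t / β t) ((β t)⁻¹ • y)
  have hid := integrable_posterior_id hR (α t / β t) ((β t)⁻¹ • y)
  rw [velocity, tiltedPosterior_eq_posterior hβ, posteriorMean, ← integral_smul]
  set μ := posterior P₀ (α t / β t) ((β t)⁻¹ • y)
  set c := derivWithin α (Icc 0 1) t - derivWithin β (Icc 0 1) t * (α t / β t) with hc
  have h1 : ∀ x, interpDeriv α β t (x, (β t)⁻¹ • (y - α t • x))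
      = derivWithin β (Icc 0 1) t • (β t)⁻¹ • y + c • x := fun x => by
    simp only [interpDeriv, hc, smul_sub, smul_smul, sub_smul, div_eq_mul_inv]
    rw [mul_comm (β t)⁻¹ (α t), ← mul_assoc]
    abel
  simp_rw [h1]
  have hci : Integrable (fun x => c • x) μ := hid.smul c
  rw [integral_add (integrable_const _) hci]
  simp

lemma norm_velocity_sub_le (hR : ∀ᵐ x ∂P₀, ‖x‖ ≤ R) (hβ : β t ≠ 0)
    (y y' : EuclideanSpace ℝ (Fin N)) :
    ‖velocity P₀ α β t y' - velocity P₀ α β t y‖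
      ≤ (|derivWithin β (Icc 0 1) t| * |(β t)⁻¹|
        + |derivWithin α (Icc 0 1) t - derivWithin β (Icc 0 1) t * (α t / β t)|
          * (4 * R ^ 2 * |α t / β t| * |(β t)⁻¹|)) * ‖y' - y‖ := by
  rw [velocity_eq hR hβ, velocity_eq hR hβ, add_sub_add_comm, ← smul_sub, ← smul_sub, ← smul_sub]
  refine (norm_add_le _ _).trans ?_
  have h := norm_posteriorMean_sub_le_mul hR (α t / β t) ((β t)⁻¹ • y) ((β t)⁻¹ • y')
  rw [← smul_sub, norm_smul, Real.norm_eq_abs] at h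
  rw [norm_smul, norm_smul, norm_smul, Real.norm_eq_abs, Real.norm_eq_abs, Real.norm_eq_abs]
  have h2 := mul_le_mul_of_nonneg_left h
    (abs_nonneg (derivWithin α (Icc 0 1) t - derivWithin β (Icc 0 1) t * (α t / β t)))
  linarith

lemma continuous_velocity (hR : ∀ᵐ x ∂P₀, ‖x‖ ≤ R) (hβ : β t ≠ 0) :
    Continuous (velocity P₀ α β t) := by
  rw [funext (velocity_eq hR hβ)]
  have := continuous_posteriorMean hR (α t / β t)
  fun_prop

lemma integrable_jointLaw_fst (hR : ∀ᵐ x ∂P₀, ‖x‖ ≤ R) :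
    Integrable (fun p => p.1) (jointLaw P₀) :=
  Integrable.comp_fst (f := fun x => x) (Integrable.of_bound aestronglyMeasurable_id R hR) _

lemma integrable_jointLaw_snd : Integrable (fun p => p.2) (jointLaw P₀) :=
  Integrable.comp_snd (f := fun x => x) IsGaussian.integrable_id _

/-- The velocity field is a version of the conditional expectation of the time derivative of the
interpolant given its value. -/
lemma condExp_interpDeriv_ae_eq (hR : ∀ᵐ x ∂P₀, ‖x‖ ≤ R) (hβ : β t ≠ 0) :
    (jointLaw P₀)[interpDeriv α β t | MeasurableSpace.comap (interp α β t) inferInstance]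
      =ᵐ[jointLaw P₀] fun p => velocity P₀ α β t (interp α β t p) := by
  have : IsProbabilityMeasure (jointLaw P₀) := by unfold jointLaw; infer_instance
  have hm : Measurable (interp (N := N) α β t) := by unfold interp; fun_prop
  have hi1 := integrable_jointLaw_fst hR
  have hi2 := integrable_jointLaw_snd (P₀ := P₀)
  have hfi : Integrable (interpDeriv (N := N) α β t) (jointLaw P₀) :=
    (hi1.smul (derivWithin α (Icc 0 1) t)).add (hi2.smul (derivWithin β (Icc 0 1) t))
  have hvel := continuous_velocity (α := α) hR hβ
  set s := α t / β t with hs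
  set c := derivWithin α (Icc 0 1) t - derivWithin β (Icc 0 1) t * s with hc
  have hinterp : ∀ p : EuclideanSpace ℝ (Fin N) × EuclideanSpace ℝ (Fin N),
      interp α β t p = β t • (s • p.1 + p.2) := fun p => by
    rw [interp, smul_add, smul_smul, hs, mul_div_cancel₀ _ hβ]
  have hmean : Continuous fun p : EuclideanSpace ℝ (Fin N) × EuclideanSpace ℝ (Fin N) =>
      posteriorMean P₀ s (s • p.1 + p.2) :=
    (continuous_posteriorMean hR s).comp (by fun_prop)
  have hgi : Integrable (fun p => velocity P₀ α β t (interp α β t p)) (jointLaw P₀) := by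
    have h1 : Integrable (fun p => c • posteriorMean P₀ s (s • p.1 + p.2)) (jointLaw P₀) :=
      (Integrable.of_bound hmean.aestronglyMeasurable R
        (Filter.Eventually.of_forall fun p => norm_posteriorMean_le hR _ _)).smul c
    have h2 : Integrable (fun p => derivWithin β (Icc 0 1) t • (s • p.1 + p.2)) (jointLaw P₀) :=
      ((hi1.smul s).add hi2).smul (derivWithin β (Icc 0 1) t)
    refine (h2.add h1).congr (Filter.Eventually.of_forall fun p => ?_)
    simp only [Pi.add_apply]
    rw [velocity_eq hR hβ, hinterp, inv_smul_smul₀ hβ]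
  refine (ae_eq_condExp_of_forall_setIntegral_eq hm.comap_le hfi
    (fun _ _ _ => hgi.integrableOn) ?_ ?_).symm
  · rintro _ ⟨A, hA, rfl⟩ -
    rw [← integral_indicator (hm hA), ← integral_indicator (hm hA)]
    set G : EuclideanSpace ℝ (Fin N) × EuclideanSpace ℝ (Fin N) → EuclideanSpace ℝ (Fin N) :=
      indicator ((fun q => β t • q.2) ⁻¹' A)
        (fun q => interpDeriv α β t (q.1, (β t)⁻¹ • (β t • q.2 - α t • q.1))) with hGdef
    have hAm : MeasurableSet ((fun q : EuclideanSpace ℝ (Fin N) × EuclideanSpace ℝ (Fin N) =>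
        β t • q.2) ⁻¹' A) := by
      have : Measurable fun q : EuclideanSpace ℝ (Fin N) × EuclideanSpace ℝ (Fin N) =>
        β t • q.2 := by fun_prop
      exact this hA
    have hG : StronglyMeasurable G := by
      refine StronglyMeasurable.indicator ?_ hAm
      unfold interpDeriv
      exact Continuous.stronglyMeasurable (by fun_prop)
    -- evaluated at `(x₀, s x₀ + z)`, `G` is the restriction of the time derivative to the event
    have hG1 : (fun p : EuclideanSpace ℝ (Fin N) × EuclideanSpace ℝ (Fin N) =>
        G (p.1, s • p.1 + p.2))
        = indicator (interp α β t ⁻¹' A) (interpDeriv α β t) := by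
      ext1 p
      have e : (β t)⁻¹ • (interp α β t p - α t • p.1) = p.2 := by
        rw [interp, add_sub_cancel_left, inv_smul_smul₀ hβ]
      by_cases hp : interp α β t p ∈ A
      · simp only [hGdef, indicator, mem_preimage, ← hinterp, e, hp, if_true]
      · simp only [hGdef, indicator, mem_preimage, ← hinterp, hp, if_false]
    -- integrating over the posterior law replaces the time derivative by the velocity
    have hG2 : (fun p : EuclideanSpace ℝ (Fin N) × EuclideanSpace ℝ (Fin N) =>
        ∫ x, G (x, s • p.1 + p.2) ∂(posterior P₀ s (s • p.1 + p.2)))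
        = indicator (interp α β t ⁻¹' A) (fun p => velocity P₀ α β t (interp α β t p)) := by
      ext1 p
      have e : posterior P₀ s (s • p.1 + p.2) = tiltedPosterior P₀ α β t (interp α β t p) := by
        rw [tiltedPosterior_eq_posterior hβ, hinterp, inv_smul_smul₀ hβ]
      rw [e]
      by_cases hp : interp α β t p ∈ A
      · simp only [hGdef, indicator, mem_preimage, ← hinterp, hp, if_true, velocity]
      · simp only [hGdef, indicator, mem_preimage, ← hinterp, hp, if_false,
          integral_zero]
    have key := integral_posterior_comp_shear (s := s) hR hG
      (by rw [hG1]; exact hfi.indicator (hm hA)) (by rw [hG2]; exact hgi.indicator (hm hA))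
    rw [hG1, hG2] at key
    exact key
  · exact (hvel.stronglyMeasurable.comp_measurable
      (comap_measurable (interp α β t))).aestronglyMeasurable

end Velocity

/-! ### The flow of the velocity field -/

section Flow

variable {N : ℕ} {P₀ : Measure (EuclideanSpace ℝ (Fin N))} [IsProbabilityMeasure P₀]
  {α β : ℝ → ℝ} {ε R S : ℝ}

lemma Icc_subset_Icc_zero_one (hε : ε ∈ Ioo (0 : ℝ) 1) : Icc ε 1 ⊆ Icc (0 : ℝ) 1 :=
  Icc_subset_Icc_left hε.1.le

lemma IsSchedule.beta_ne_zero (hαβ : IsSchedule α β) (hε : ε ∈ Ioo (0 : ℝ) 1) {t : ℝ}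
    (ht : t ∈ Icc ε 1) : β t ≠ 0 :=
  (hαβ.beta_pos t ⟨hε.1.trans_le ht.1, ht.2⟩).ne'

lemma IsSchedule.hasDerivWithinAt_alpha (hαβ : IsSchedule α β) (hε : ε ∈ Ioo (0 : ℝ) 1) {t : ℝ}
    (ht : t ∈ Icc ε 1) : HasDerivWithinAt α (derivWithin α (Icc 0 1) t) (Icc ε 1) t :=
  ((hαβ.contDiffOn_alpha.differentiableOn one_ne_zero t
    (Icc_subset_Icc_zero_one hε ht)).hasDerivWithinAt).mono (Icc_subset_Icc_zero_one hε)

lemma IsSchedule.hasDerivWithinAt_beta (hαβ : IsSchedule α β) (hε : ε ∈ Ioo (0 : ℝ) 1) {t : ℝ}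
    (ht : t ∈ Icc ε 1) : HasDerivWithinAt β (derivWithin β (Icc 0 1) t) (Icc ε 1) t :=
  ((hαβ.contDiffOn_beta.differentiableOn one_ne_zero t
    (Icc_subset_Icc_zero_one hε ht)).hasDerivWithinAt).mono (Icc_subset_Icc_zero_one hε)

lemma IsSchedule.continuousOn_ratio (hαβ : IsSchedule α β) (hε : ε ∈ Ioo (0 : ℝ) 1) :
    ContinuousOn (fun t => α t / β t) (Icc ε 1) :=
  (hαβ.contDiffOn_alpha.continuousOn.mono (Icc_subset_Icc_zero_one hε)).div
    (hαβ.contDiffOn_beta.continuousOn.mono (Icc_subset_Icc_zero_one hε))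
    fun _ ht => hαβ.beta_ne_zero hε ht

lemma IsSchedule.exists_ratio_mem_Icc (hαβ : IsSchedule α β) (hε : ε ∈ Ioo (0 : ℝ) 1) :
    ∃ S, 0 ≤ S ∧ ∀ t ∈ Icc ε 1, α t / β t ∈ Icc 0 S := by
  obtain ⟨S, hS⟩ := isCompact_Icc.exists_bound_of_continuousOn (hαβ.continuousOn_ratio hε)
  refine ⟨S, (norm_nonneg _).trans (hS 1 ⟨hε.2.le, le_rfl⟩), fun t ht => ⟨?_, ?_⟩⟩
  · have ht' := Icc_subset_Icc_zero_one hε ht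
    exact div_nonneg (hαβ.alpha_nonneg t ht') (hαβ.beta_nonneg t ht')
  · exact (le_abs_self _).trans (hS t ht)

/-- Rescaling space by `β` and reparametrizing time by `α / β` turns the posterior mean flow into
the flow of the velocity field. -/
lemma IsPosteriorFlow.isBackwardFlow {W : ℝ → EuclideanSpace ℝ (Fin N) → EuclideanSpace ℝ (Fin N)}
    (hW : IsPosteriorFlow P₀ S W) (hR : ∀ᵐ x ∂P₀, ‖x‖ ≤ R) (hαβ : IsSchedule α β)
    (hε : ε ∈ Ioo (0 : ℝ) 1) (hS : ∀ t ∈ Icc ε 1, α t / β t ∈ Icc 0 S) :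
    IsBackwardFlow P₀ α β ε (fun t z => β t • W (α t / β t) z) where
  initial z := by simp [hαβ.alpha_one, hαβ.beta_one, hW.initial]
  hasDerivWithinAt z t ht := by
    have hβ := hαβ.beta_ne_zero hε ht
    have hα' := hαβ.hasDerivWithinAt_alpha hε ht
    have hβ' := hαβ.hasDerivWithinAt_beta hε ht
    have hr : HasDerivWithinAt (fun t => α t / β t) _ (Icc ε 1) t := hα'.div hβ' hβ
    have hc := (hW.hasDerivWithinAt z (α t / β t) (hS t ht)).scomp t hr hS
    have h : HasDerivWithinAt (fun t => β t • W (α t / β t) z) _ (Icc ε 1) t := hβ'.smul hc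
    refine h.congr_deriv ?_
    rw [velocity_eq hR hβ, inv_smul_smul₀ hβ, smul_smul, add_comm]
    congr 2
    field_simp

lemma IsBackwardFlow.eq_of_isBackwardFlow
    {Y Y' : ℝ → EuclideanSpace ℝ (Fin N) → EuclideanSpace ℝ (Fin N)}
    (hY : IsBackwardFlow P₀ α β ε Y) (hY' : IsBackwardFlow P₀ α β ε Y')
    (hR : ∀ᵐ x ∂P₀, ‖x‖ ≤ R) (hαβ : IsSchedule α β) (hε : ε ∈ Ioo (0 : ℝ) 1) {t : ℝ}
    (ht : t ∈ Icc ε 1) : Y' t = Y t := by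
  have hsub := Icc_subset_Icc_zero_one hε
  have hcα : ContinuousOn (derivWithin α (Icc 0 1)) (Icc ε 1) :=
    (hαβ.contDiffOn_alpha.continuousOn_derivWithin (uniqueDiffOn_Icc zero_lt_one) le_rfl).mono hsub
  have hcβ : ContinuousOn (derivWithin β (Icc 0 1)) (Icc ε 1) :=
    (hαβ.contDiffOn_beta.continuousOn_derivWithin (uniqueDiffOn_Icc zero_lt_one) le_rfl).mono hsub
  have hcr := hαβ.continuousOn_ratio hε
  have hci : ContinuousOn (fun t => (β t)⁻¹) (Icc ε 1) :=
    (hαβ.contDiffOn_beta.continuousOn.mono hsub).inv₀ fun _ ht => hαβ.beta_ne_zero hε ht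
  -- by compactness of `[ε, 1]` the Lipschitz constant of the velocity is bounded in time
  obtain ⟨K, hK⟩ := isCompact_Icc.exists_bound_of_continuousOn
    ((hcβ.abs.mul hci.abs).add ((hcα.sub (hcβ.mul hcr)).abs.mul
      ((continuousOn_const (c := 4 * R ^ 2)).mul hcr.abs |>.mul hci.abs)))
  have hlip : ∀ t ∈ Ioc ε 1, LipschitzOnWith K.toNNReal (velocity P₀ α β t) univ := fun t ht => by
    have ht' := Ioc_subset_Icc_self ht
    refine LipschitzOnWith.of_dist_le_mul fun y' _ y _ => ?_
    rw [dist_eq_norm, dist_eq_norm]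
    refine (norm_velocity_sub_le hR (hαβ.beta_ne_zero hε ht') y y').trans ?_
    refine mul_le_mul_of_nonneg_right ?_ (norm_nonneg _)
    exact ((le_abs_self _).trans (hK t ht')).trans (Real.le_coe_toNNReal K)
  have hderiv : ∀ {X : ℝ → EuclideanSpace ℝ (Fin N) → EuclideanSpace ℝ (Fin N)},
      IsBackwardFlow P₀ α β ε X → ∀ z, ∀ t ∈ Ioc ε 1,
        HasDerivWithinAt (fun s => X s z) (velocity P₀ α β t (X t z)) (Iic t) t :=
    fun hX z t ht => (hX.hasDerivWithinAt z t (Ioc_subset_Icc_self ht)).mono_of_mem_nhdsWithin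
      (Filter.mem_of_superset (Icc_mem_nhdsLE ht.1) (Icc_subset_Icc_right ht.2))
  have hcont : ∀ {X : ℝ → EuclideanSpace ℝ (Fin N) → EuclideanSpace ℝ (Fin N)},
      IsBackwardFlow P₀ α β ε X → ∀ z, ContinuousOn (fun s => X s z) (Icc ε 1) :=
    fun hX z t ht => (hX.hasDerivWithinAt z t ht).continuousWithinAt
  ext1 z
  exact ODE_solution_unique_of_mem_Icc_left hlip (hcont hY' z) (hderiv hY' z)
    (fun _ _ => mem_univ _) (hcont hY z) (hderiv hY z) (fun _ _ => mem_univ _)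
    (by rw [hY.initial, hY'.initial]) ht

omit [IsProbabilityMeasure P₀] in
lemma map_smul_eq_interpLaw {W : EuclideanSpace ℝ (Fin N) → EuclideanSpace ℝ (Fin N)}
    {t : ℝ} (hβ : β t ≠ 0) (hWm : Measurable W)
    (hW : (stdGaussian (EuclideanSpace ℝ (Fin N))).map W
      = (P₀.prod (stdGaussian (EuclideanSpace ℝ (Fin N)))).map
        (fun p => (α t / β t) • p.1 + p.2)) :
    (stdGaussian (EuclideanSpace ℝ (Fin N))).map (fun z => β t • W z)
      = interpLaw P₀ α β t := by
  have hm : Measurable fun v : EuclideanSpace ℝ (Fin N) => β t • v := by fun_prop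
  have h1 : (stdGaussian (EuclideanSpace ℝ (Fin N))).map (fun z => β t • W z)
      = ((stdGaussian (EuclideanSpace ℝ (Fin N))).map W).map (fun v => β t • v) :=
    (Measure.map_map hm hWm).symm
  rw [h1, hW, Measure.map_map hm (by fun_prop), interpLaw, jointLaw]
  congr 1
  ext1 p
  rw [Function.comp_apply, interp, smul_add, smul_smul, mul_div_cancel₀ _ hβ]

end Flow
end Interpolant

theorem mainTheorem2 {N : ℕ} (P₀ : Measure (EuclideanSpace ℝ (Fin N))) [IsProbabilityMeasure P₀]
    (hP₀ : Bornology.IsBounded P₀.support) (α β : ℝ → ℝ) (hαβ : IsSchedule α β)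
    (ε : ℝ) (hε : ε ∈ Ioo (0 : ℝ) 1) :
    -- `b(·,t)` is the continuous version of the conditional expectation of `y'(t)` given `y(t)`
    (∀ t ∈ Icc ε 1, Continuous (velocity P₀ α β t) ∧
      (jointLaw P₀)[interpDeriv α β t |
          MeasurableSpace.comap (interp α β t) inferInstance]
        =ᵐ[jointLaw P₀] fun p => velocity P₀ α β t (interp α β t p)) ∧
    -- the flow exists
    (∃ Y, IsBackwardFlow P₀ α β ε Y) ∧
    -- it is unique, and transports the Gaussian to the law of the interpolant
    ∀ Y, IsBackwardFlow P₀ α β ε Y →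
      (∀ Y', IsBackwardFlow P₀ α β ε Y' → ∀ t ∈ Icc ε 1, Y' t = Y t) ∧
      ∀ t ∈ Icc ε 1, Measurable (Y t) ∧
        (stdGaussian (EuclideanSpace ℝ (Fin N))).map (Y t) = interpLaw P₀ α β t := by
  obtain ⟨R, hR'⟩ := hP₀.subset_closedBall 0
  have hR : ∀ᵐ x ∂P₀, ‖x‖ ≤ R := by
    filter_upwards [Measure.support_mem_ae (μ := P₀)] with x hx
    simpa using hR' hx
  obtain ⟨S, hS0, hS⟩ := hαβ.exists_ratio_mem_Icc hε
  obtain ⟨W, hW⟩ := exists_isPosteriorFlow hR hS0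
  have hflow := hW.isBackwardFlow hR hαβ hε hS
  refine ⟨fun t ht => ⟨continuous_velocity hR (hαβ.beta_ne_zero hε ht),
    condExp_interpDeriv_ae_eq hR (hαβ.beta_ne_zero hε ht)⟩, ⟨_, hflow⟩, fun Y hY =>
    ⟨fun Y' hY' t ht => hY.eq_of_isBackwardFlow hY' hR hαβ hε ht, fun t ht => ?_⟩⟩
  have hWm := hW.measurable hR (hS t ht)
  rw [hflow.eq_of_isBackwardFlow hY hR hαβ hε ht]
  exact ⟨hWm.const_smul (β t), map_smul_eq_interpLaw (hαβ.beta_ne_zero hε ht) hWm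
    (hW.map_stdGaussian hR (hS t ht))⟩
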